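/- **The sets.** Let $H_n$ be the finite collection of hereditarily finite sets of rank at most $n$, and put $F(0,A)=\emptyset$, $F(n+1,A)=\{F(n,a)\mid a\in A\}$ for hereditarily finite $A$. In the theory AS (approximations of sets) a *set* $A$ is a sequence $F(0,A),F(1,A),F(2,A),\dots$ with $F(n,A)\in H_n$ and $F(n,F(n+1,A))=F(n,A)$ for every $n$; and $x\in A$ means that $F(n,x)\in F(n+1,A)$ for every $n$. Ordered pairs are $(a,b)=\{\{a\},\{a,b\}\}$. Relations between $A$ and $B$, functions, injections and bijections are *sets of AS* of ordered pairs $(a,b)$, $a\in A$, $b\in B$, with the usual properties. Write $A\le_c B$ if there is an injection from $A$ into $B$; $A=_cB$ if $A\le_cB$ and $B\le_cA$; $A<_cB$ if $A\le_cB$ but not $A=_cB$. **Topology.** The neighborhoods of $x$ are $V(n,x)=\{y\mid F(n,y)=F(n,x)\}$, $n\in\mathbb N$. The derived set $A'$ is the set of all accumulation points of $A$, i.e. of all $x$ such that every $V(n,x)$ contains some $y\in A$, $y\ne x$. **Well-orderings.** A set $A$ is *well-ordered* by a set $R$ of ordered pairs of elements of $A$ if $R$ is (the weak form $\le$ of)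 a linear ordering of $A$, every nonempty set $B\subseteq A$ has an $R$-minimal element, and every $x\in A$ is upward isolated, i.e. has a neighborhood containing no $y\in A$ with $x<y$. $A$ is *well-orderable* if some $R$ well-orders it. An *ordinal* is a well-ordered set $(A,R)$. For ordinals, $\alpha\le_o\beta$ ($\alpha<_o\beta$) means that there is an order isomorphism from $\alpha$ onto an initial segment (a proper initial segment) of $\beta$, where isomorphisms and initial segments are sets of AS; $\alpha=_o\beta$ means $\alpha\le_o\beta$ and $\beta\le_o\alpha$. A nonempty ordinal $\beta$ is a *successor* of $\alpha$, and $\alpha$ a *predecessor* of $\beta$, if the elements of $\beta$ other than $\max\beta$ form a set and this set, with the inherited ordering, is $=_o\alpha$. A nonempty ordinal without a predecessor is a *limit ordinal*. **Rank and degree.** Put $A^{(\emptyset)}=A$; $A^{(\alpha)}=(A^{(\pi)})'$ if $\pi$ is a predecessor of $\alpha$; and $A^{(\alpha)}=\{x\mid x\in A^{(\beta)}\text{ for every }\beta<_o\alpha\}$ if $\alpha$ is a limit ordinal. A *Cantor–Bendixson rank* $r_{CB}(A)$ is a smallest ordinal $\alpha$ with respect to $\le_o$ such that $(A^{(\alpha)})'=\emptyset$,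 and the *Cantor–Bendixson degree* is $d_{CB}(A)=A^{(\alpha)}$ for such an $\alpha$. **Theorem 8.20 (with Theorem 8.21).** Let $A$ and $B$ be well-orderable sets. Then $A$ and $B$ have Cantor–Bendixson ranks, their Cantor–Bendixson degrees exist, are uniquely determined and are well-orderable, and, for any choice of the ranks and any well-orderings of the degrees, $$A=_cB\iff r_{CB}(A)=_or_{CB}(B)\ \text{ and }\ d_{CB}(A)=_od_{CB}(B),$$ $$A<_cB\iff r_{CB}(A)<_or_{CB}(B),\ \text{ or }\ r_{CB}(A)=_or_{CB}(B)\text{ and }d_{CB}(A)<_od_{CB}(B).$$ -/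

import Mathlib

namespace AS

/-! ### Hereditarily finite sets and their approximations -/

/-- `HF n` is the (finite) type of hereditarily finite sets of rank at most `n`: rank `0` is only
the empty set, and a hereditarily finite set of rank at most `n + 1` is an arbitrary collection of
hereditarily finite sets of rank at most `n` (automatically finite, see `HF.finite`).
So `HF n` consists of the nodes of level `n` of the universal tree. -/
def HF : ℕ → Type
  | 0 => Unit
  | n + 1 => Set (HF n)

theorem HF.finite : ∀ n : ℕ, Finite (HF n)
  | 0 => inferInstanceAs (Finite Unit)
  | n + 1 => by
      have := HF.finite n
      exact inferInstanceAs (Finite (Set (HF n)))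

/-- The elements of a hereditarily finite set of rank at most `n + 1`. -/
def HF.elems {n : ℕ} (A : HF (n + 1)) : Set (HF n) := A

/-- The hereditarily finite set of rank at most `n + 1` with the given elements. -/
def HF.ofElems {n : ℕ} (s : Set (HF n)) : HF (n + 1) := s

/-- The `n`-th approximation `F(n, A)` of a hereditarily finite set `A` of rank at most `n + 1`:
`F(0, A) = ∅` and `F(n + 1, A) = {F(n, a) | a ∈ A}`. -/
def HF.approx : (n : ℕ) → HF (n + 1) → HF n
  | 0, _ => ()
  | n + 1, A => HF.ofElems (HF.approx n '' HF.elems A)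

/-! ### Sets -/

/-- A set of the theory is an infinite path through the universal tree, i.e. a developing sequence
`F(0, A), F(1, A), F(2, A), …` with `F(n, F(n + 1, A)) = F(n, A)` for every `n`. -/
@[ext]
structure ASet : Type where
  F : (n : ℕ) → HF n
  compat : ∀ n, HF.approx n (F (n + 1)) = F n

/-- `x ∈ A` means that `F(n, x) ∈ F(n + 1, A)` for every `n`. -/
instance : Membership ASet ASet :=
  ⟨fun A x => ∀ n, x.F n ∈ HF.elems (A.F (n + 1))⟩

instance : HasSubset ASet := ⟨fun A B => ∀ x, x ∈ A → x ∈ B⟩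

/-- The set has no elements. -/
def IsEmptySet (A : ASet) : Prop := ∀ x, x ∉ A

/-- The unordered pair `{a, b}`; its `(n + 1)`-th approximation is `{F(n, a), F(n, b)}`. -/
def pair (a b : ASet) : ASet where
  F
    | 0 => ()
    | n + 1 => HF.ofElems {a.F n, b.F n}
  compat
    | 0 => rfl
    | n + 1 => by
        show HF.approx n '' {a.F (n + 1), b.F (n + 1)} = {a.F n, b.F n}
        rw [Set.image_pair, a.compat, b.compat]

/-- The ordered pair `(a, b) = {{a}, {a, b}}`. -/
def opair (a b : ASet) : ASet := pair (pair a a) (pair a b)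

/-! ### Relations, functions, cardinality. These are sets of the theory. -/

/-- `R` is a relation between the elements of `A` and `B`: `R ⊆ A × B`. -/
def IsRelation (R A B : ASet) : Prop :=
  ∀ z, z ∈ R → ∃ a b, a ∈ A ∧ b ∈ B ∧ z = opair a b

/-- `f : A → B`: a total functional relation between the elements of `A` and `B`. -/
def IsFunction (f A B : ASet) : Prop :=
  IsRelation f A B ∧
  (∀ a, a ∈ A → ∃ b, b ∈ B ∧ opair a b ∈ f) ∧
  (∀ a b b', opair a b ∈ f → opair a b' ∈ f → b = b')

def IsInjection (f A B : ASet) : Prop :=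
  IsFunction f A B ∧ ∀ a a' b, opair a b ∈ f → opair a' b ∈ f → a = a'

def IsBijection (f A B : ASet) : Prop :=
  IsInjection f A B ∧ ∀ b, b ∈ B → ∃ a, a ∈ A ∧ opair a b ∈ f

/-- `A ≤_c B` -/
def CardLE (A B : ASet) : Prop := ∃ f, IsInjection f A B

/-- `A =_c B` -/
def CardEq (A B : ASet) : Prop := CardLE A B ∧ CardLE B A

/-- `A <_c B` -/
def CardLT (A B : ASet) : Prop := CardLE A B ∧ ¬ CardEq A B

/-! ### The topology of approximations -/

/-- `y` lies in the neighborhood `V(n, x)`. -/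
def InNhd (n : ℕ) (x y : ASet) : Prop := y.F n = x.F n

/-- `x` is an accumulation point in `A`. -/
def IsAccPoint (x A : ASet) : Prop := ∀ n, ∃ y, y ∈ A ∧ y ≠ x ∧ InNhd n x y

/-- `A'` is the derived set of `A`. -/
def IsDerivedSet (A' A : ASet) : Prop := ∀ x, x ∈ A' ↔ IsAccPoint x A

/-! ### Well-orderings -/

/-- The set `R` of the theory linearly orders `A`. An ordering is represented by its weak form:
`opair x y ∈ R` says that `x` is smaller than or equal to `y`. -/
def LinearlyOrders (R A : ASet) : Prop :=
  IsRelation R A A ∧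
  (∀ x y, opair x y ∈ R → opair y x ∈ R → x = y) ∧
  (∀ x y z, opair x y ∈ R → opair y z ∈ R → opair x z ∈ R) ∧
  (∀ x y, x ∈ A → y ∈ A → opair x y ∈ R ∨ opair y x ∈ R)

/-- `R` well-orders `A`: it linearly orders `A`, every nonempty set `B ⊆ A` has a minimal element,
and every `x ∈ A` is upward isolated: some neighborhood of `x` contains no greater element of
`A`. -/
def WellOrders (R A : ASet) : Prop :=
  LinearlyOrders R A ∧
  (∀ B, B ⊆ A → ¬ IsEmptySet B → ∃ m, m ∈ B ∧ ∀ x, x ∈ B → opair m x ∈ R) ∧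
  (∀ x, x ∈ A → ∃ n, ∀ y, y ∈ A → y ≠ x → InNhd n x y → opair x y ∉ R)

def WellOrderable (A : ASet) : Prop := ∃ R, WellOrders R A

/-- `S` is an initial segment of `A` with regard to the ordering `R`. -/
def IsInitialSegment (S A R : ASet) : Prop :=
  S ⊆ A ∧ ∀ x y, x ∈ S → y ∈ A → opair y x ∈ R → y ∈ S

/-- `f` is an isomorphism from `A₁`, ordered by `R₁`, onto `A₂`, ordered by `R₂` (only the
restriction of `R₂` to `A₂` matters). -/
def IsIsomorphism (f A₁ R₁ A₂ R₂ : ASet) : Prop :=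
  IsBijection f A₁ A₂ ∧
  ∀ x₁ x₂ y₁ y₂, opair x₁ y₁ ∈ f → opair x₂ y₂ ∈ f → opair x₁ x₂ ∈ R₁ → opair y₁ y₂ ∈ R₂

/-! ### Ordinals -/

/-- An ordinal is an arbitrary well-ordered set. -/
structure WOSet : Type where
  carrier : ASet
  rel : ASet
  wellOrders : WellOrders rel carrier

/-- `α ≤_o β`: `α` is isomorphic to an initial segment of `β`. -/
def OrdLE (α β : WOSet) : Prop :=
  ∃ S f, IsInitialSegment S β.carrier β.rel ∧ IsIsomorphism f α.carrier α.rel S β.rel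

/-- `α =_o β` -/
def OrdEq (α β : WOSet) : Prop := OrdLE α β ∧ OrdLE β α

/-- `α <_o β`: `α` is isomorphic to a proper initial segment of `β`. -/
def OrdLT (α β : WOSet) : Prop :=
  ∃ S f, IsInitialSegment S β.carrier β.rel ∧ S ≠ β.carrier ∧
    IsIsomorphism f α.carrier α.rel S β.rel

/-- `m` is the maximal element of `β`. -/
def IsMax (m : ASet) (β : WOSet) : Prop :=
  m ∈ β.carrier ∧ ∀ x, x ∈ β.carrier → opair x m ∈ β.rel

/-- `γ` is `β` without its maximal element, with the inherited ordering. Such a `γ` exists only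
if the elements of `β` other than the maximal one form a set of the theory. -/
def IsRemoveMax (γ β : WOSet) : Prop :=
  (∃ m, IsMax m β ∧ ∀ x, x ∈ γ.carrier ↔ x ∈ β.carrier ∧ x ≠ m) ∧
  ∀ x y, x ∈ γ.carrier → y ∈ γ.carrier → (opair x y ∈ γ.rel ↔ opair x y ∈ β.rel)

/-- `β` is a successor of `α` (and `α` is a predecessor of `β`). -/
def IsSuccessor (β α : WOSet) : Prop := ∃ γ, IsRemoveMax γ β ∧ OrdEq γ α

/-- A limit ordinal is a nonempty ordinal without a predecessor. -/
def IsLimit (α : WOSet) : Prop := ¬ IsEmptySet α.carrier ∧ ¬ ∃ π, IsSuccessor α π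

/-! ### Iterated derived sets, Cantor–Bendixson rank and degree -/

/-- `IsIterDerived A α X` says that `X = A^(α)`, by transfinite recursion on `α`: `A^(∅) = A`;
`A^(α)` is the derived set of `A^(π)` if `π` is a predecessor of `α`; and for a limit ordinal `α`,
`A^(α)` is the set of all `x` that lie in `A^(β)` for every `β <_o α`. -/
inductive IsIterDerived (A : ASet) : WOSet → ASet → Prop
  | zero (α : WOSet) (hα : IsEmptySet α.carrier) : IsIterDerived A α A
  | succ (α π : WOSet) (hα : IsSuccessor α π) (X Y : ASet) (hX : IsIterDerived A π X)
      (hY : IsDerivedSet Y X) : IsIterDerived A α Y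
  | limit (α : WOSet) (hα : IsLimit α) (X : WOSet → ASet)
      (hX : ∀ β, OrdLT β α → IsIterDerived A β (X β)) (Y : ASet)
      (hY : ∀ x, x ∈ Y ↔ ∀ β, OrdLT β α → x ∈ X β) : IsIterDerived A α Y

/-- `(A^(α))' = ∅` -/
def DerivesToDiscrete (A : ASet) (α : WOSet) : Prop :=
  ∃ X, IsIterDerived A α X ∧ ∃ Z, IsDerivedSet Z X ∧ IsEmptySet Z

/-- `α` is a Cantor–Bendixson rank of `A`: a smallest ordinal with `(A^(α))' = ∅`. -/
def IsCBRank (A : ASet) (α : WOSet) : Prop :=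
  DerivesToDiscrete A α ∧ ∀ β, DerivesToDiscrete A β → OrdLE α β

/-- `D` is the Cantor–Bendixson degree of `A`: `D = A^(α)` for a Cantor–Bendixson rank `α`. -/
def IsCBDegree (A D : ASet) : Prop := ∃ α, IsCBRank A α ∧ IsIterDerived A α D

end AS

namespace AS

open Set Filter Topology

/-! The sequences form a closed subspace of a product of finite discrete spaces, hence a compact
Hausdorff space whose basic neighborhoods are the cells `V(n, x)`. Taking elements identifies sets
with closed subsets (`points_ofSet`, `points_injective`), and by compactness functions of the theory
are continuous maps. So `A ≤_c B` means that the compact set `A` embeds topologically into `B`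
(`cardLE_iff`).

A well-ordered set is a compact ordered space in which every `Iic x` is open. It is truly
well-founded, and order isomorphisms onto initial segments are automatically continuous, so they are
sets of the theory. Thus `≤_o` compares ordinary order types. Since a nonempty compact order has a
maximum, these types are zero or successors; a limit ordinal of the theory has type `λ + 1` with `λ`
a limit.

An embedding carries iterated derived sets into iterated derived sets, so it can lower neither the
rank nor, at equal rank, the finite number of points in the last nonempty derived set. Conversely,
`embeds_of_derived_subset_singleton` embeds a set with at most one point of rank `w` near any point
of rank at least `w`, and `embeds_of_injOn_derived` pastes finitely many such embeddings.
Embeddability is therefore the lexicographic order of rank and degree (`embeds_iff`).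
Well-orderability ensures that the rank exists: upward isolation forces points of high rank to have
a high position (`WOSet.otype_le_of_mem_derived`). -/

instance (n : ℕ) : Finite (HF n) := HF.finite n

instance (n : ℕ) : TopologicalSpace (HF n) := ⊥

instance (n : ℕ) : DiscreteTopology (HF n) := ⟨rfl⟩

/-! ### The compact space of sequences; sets as closed subsets -/

namespace ASet

instance : TopologicalSpace ASet := TopologicalSpace.induced ASet.F inferInstance

theorem F_injective : Function.Injective ASet.F := fun _ _ h => ASet.ext h

theorem isEmbedding_F : IsEmbedding ASet.F := ⟨⟨rfl⟩, F_injective⟩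

theorem isClosedEmbedding_F : IsClosedEmbedding ASet.F := by
  refine ⟨isEmbedding_F, ?_⟩
  have : range ASet.F = ⋂ n, {z : (n : ℕ) → HF n | HF.approx n (z (n + 1)) = z n} := by
    ext z
    simp only [mem_range, mem_iInter, mem_ofPred_eq]
    exact ⟨by rintro ⟨x, rfl⟩; exact x.compat, fun h => ⟨⟨z, h⟩, rfl⟩⟩
  rw [this]
  refine isClosed_iInter fun n => isClosed_eq ?_ (continuous_apply n)
  exact continuous_of_discreteTopology.comp (continuous_apply (n + 1))

instance : CompactSpace ASet := isClosedEmbedding_F.compactSpace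

instance : T2Space ASet := isEmbedding_F.t2Space

theorem continuous_F (n : ℕ) : Continuous fun x : ASet => x.F n :=
  (continuous_apply n).comp isEmbedding_F.continuous

theorem F_eq_of_le {x y : ASet} {m n : ℕ} (hmn : m ≤ n) (h : x.F n = y.F n) : x.F m = y.F m := by
  induction n, hmn using Nat.le_induction with
  | base => exact h
  | succ k _ ih => exact ih (by rw [← x.compat k, ← y.compat k, h])

/-- The neighborhood `V(n, x)`. -/
def cell (n : ℕ) (x : ASet) : Set ASet := {y | y.F n = x.F n}

theorem mem_cell {n : ℕ} {x y : ASet} : y ∈ cell n x ↔ y.F n = x.F n := Iff.rfl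

theorem mem_cell_self (n : ℕ) (x : ASet) : x ∈ cell n x := rfl

theorem isClopen_cell (n : ℕ) (x : ASet) : IsClopen (cell n x) :=
  (isClopen_discrete {x.F n}).preimage (continuous_F n)

theorem cell_mem_nhds (n : ℕ) (x : ASet) : cell n x ∈ 𝓝 x :=
  (isClopen_cell n x).isOpen.mem_nhds rfl

theorem cell_anti (x : ASet) {m n : ℕ} (h : m ≤ n) : cell n x ⊆ cell m x :=
  fun _ hy => F_eq_of_le h hy

theorem iInter_cell (x : ASet) : ⋂ n, cell n x = {x} := by
  ext y
  simp only [mem_iInter, mem_cell, mem_singleton_iff]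
  exact ⟨fun h => ASet.ext (funext h), by rintro rfl n; rfl⟩

theorem exists_cell_subset {x : ASet} {U : Set ASet} (hU : U ∈ 𝓝 x) : ∃ n, cell n x ⊆ U := by
  have hdir : Directed (· ⊇ ·) fun n => cell n x := fun m n =>
    ⟨max m n, cell_anti x (le_max_left m n), cell_anti x (le_max_right m n)⟩
  refine exists_subset_nhds_of_isCompact hdir (fun n => (isClopen_cell n x).isClosed.isCompact) ?_
  intro y hy
  rw [iInter_cell] at hy
  rwa [mem_singleton_iff.1 hy]

theorem nhds_hasBasis (x : ASet) : (𝓝 x).HasBasis (fun _ : ℕ => True) fun n => cell n x :=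
  ⟨fun U => ⟨fun h => by simpa using exists_cell_subset h, fun ⟨n, _, h⟩ =>
    mem_of_superset (cell_mem_nhds n x) h⟩⟩

/-- The elements of a set of the theory. -/
def points (A : ASet) : Set ASet := {x | x ∈ A}

theorem mem_def {x A : ASet} : x ∈ A ↔ ∀ n, x.F n ∈ HF.elems (A.F (n + 1)) := Iff.rfl

theorem mem_points {x A : ASet} : x ∈ points A ↔ x ∈ A := Iff.rfl

theorem isClosed_points (A : ASet) : IsClosed (points A) := by
  have : points A = ⋂ n, (fun x : ASet => x.F n) ⁻¹' HF.elems (A.F (n + 1)) := by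
    ext x; simp [mem_points, mem_def]
  rw [this]
  exact isClosed_iInter fun n => (isClosed_discrete _).preimage (continuous_F n)

/-- The set of the theory whose elements are the points of the closure of `S`. -/
def ofSet (S : Set ASet) : ASet where
  F
    | 0 => ()
    | n + 1 => HF.ofElems ((fun x : ASet => x.F n) '' S)
  compat
    | 0 => rfl
    | n + 1 => by
        change HF.approx n '' ((fun x : ASet => x.F (n + 1)) '' S) = (fun x : ASet => x.F n) '' S
        rw [image_image]
        simp only [compat]

theorem ofSet_F_succ (S : Set ASet) (n : ℕ) :
    HF.elems ((ofSet S).F (n + 1)) = (fun x : ASet => x.F n) '' S := rfl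

theorem points_ofSet {S : Set ASet} (hS : IsClosed S) : points (ofSet S) = S := by
  ext x
  simp only [mem_points, mem_def, ofSet_F_succ]
  refine ⟨fun h => ?_, fun h n => mem_image_of_mem _ h⟩
  rw [← hS.closure_eq, mem_closure_iff_nhds_basis (nhds_hasBasis x)]
  intro n _
  obtain ⟨y, hy, hxy⟩ := h n
  exact ⟨y, hy, hxy⟩

theorem mem_ofSet {S : Set ASet} (hS : IsClosed S) {x : ASet} : x ∈ ofSet S ↔ x ∈ S := by
  rw [← mem_points, points_ofSet hS]

theorem exists_F_eq : ∀ (n : ℕ) (h : HF n), ∃ x : ASet, x.F n = h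
  | 0, _ => ⟨ofSet ∅, rfl⟩
  | n + 1, h => by
      choose g hg using exists_F_eq n
      refine ⟨ofSet (g '' HF.elems h), ?_⟩
      change HF.elems ((ofSet (g '' HF.elems h)).F (n + 1)) = HF.elems h
      rw [ofSet_F_succ, image_image]
      simp [hg]

theorem elems_F_succ_succ (A : ASet) (n : ℕ) :
    HF.approx n '' HF.elems (A.F (n + 2)) = HF.elems (A.F (n + 1)) := A.compat (n + 1)

theorem F_mem_of_le {A x : ASet} {m n : ℕ} (hmn : m ≤ n) (h : x.F n ∈ HF.elems (A.F (n + 1))) :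
    x.F m ∈ HF.elems (A.F (m + 1)) := by
  induction n, hmn using Nat.le_induction with
  | base => exact h
  | succ k _ ih =>
    refine ih ?_
    rw [← elems_F_succ_succ, ← x.compat k]
    exact mem_image_of_mem _ h

/-- This is König's lemma: a node at level `n` has extensions to every finite depth inside `A`, and
compactness yields an infinite path. Extensionality rests on it. -/
theorem elems_F_succ (A : ASet) (n : ℕ) :
    HF.elems (A.F (n + 1)) = (fun x : ASet => x.F n) '' points A := by
  refine Subset.antisymm (fun h hh => ?_) ?_
  · have key : ∀ k, ∃ x : ASet, x.F (n + k) ∈ HF.elems (A.F (n + k + 1)) ∧ x.F n = h := by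
      intro k
      induction k with
      | zero =>
        obtain ⟨x, rfl⟩ := exists_F_eq n h
        exact ⟨x, hh, rfl⟩
      | succ k ih =>
        obtain ⟨x, hx, rfl⟩ := ih
        rw [← elems_F_succ_succ] at hx
        obtain ⟨h', hh', hx'⟩ := hx
        obtain ⟨y, rfl⟩ := exists_F_eq (n + k + 1) h'
        rw [y.compat] at hx'
        exact ⟨y, hh', F_eq_of_le (Nat.le_add_right n k) hx'⟩
    let K : ℕ → Set ASet := fun k => {x | x.F (n + k) ∈ HF.elems (A.F (n + k + 1)) ∧ x.F n = h}
    have hK : ∀ k, IsClosed (K k) := fun k =>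
      ((isClosed_discrete (HF.elems (A.F (n + k + 1)))).preimage (continuous_F (n + k))).inter
        ((isClosed_discrete {h}).preimage (continuous_F n))
    obtain ⟨x, hx⟩ := IsCompact.nonempty_iInter_of_sequence_nonempty_isCompact_isClosed K
      (fun k x hx => ⟨F_mem_of_le (Nat.le_succ _) hx.1, hx.2⟩) key (hK 0).isCompact hK
    rw [mem_iInter] at hx
    exact ⟨x, fun k => F_mem_of_le (Nat.le_add_left k n) (hx k).1, (hx 0).2⟩
  · rintro _ ⟨x, hx, rfl⟩
    exact hx n

theorem points_injective : Function.Injective points := by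
  intro A B h
  ext n
  cases n with
  | zero => rfl
  | succ n =>
    change HF.elems (A.F (n + 1)) = HF.elems (B.F (n + 1))
    rw [elems_F_succ, elems_F_succ, h]

theorem eq_of_mem_iff {A B : ASet} (h : ∀ x, x ∈ A ↔ x ∈ B) : A = B := points_injective (Set.ext h)

end ASet

/-! ### Pairs, closed relations and continuous functions -/

open ASet

theorem pair_eq_ofSet (a b : ASet) : pair a b = ofSet {a, b} := by
  ext n
  cases n with
  | zero => rfl
  | succ n =>
    change ({a.F n, b.F n} : Set (HF n)) = (fun x : ASet => x.F n) '' {a, b}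
    rw [image_pair]

theorem points_pair (a b : ASet) : points (pair a b) = {a, b} := by
  rw [pair_eq_ofSet, points_ofSet (toFinite _).isClosed]

theorem pair_eq_pair_iff {a b c d : ASet} :
    pair a b = pair c d ↔ a = c ∧ b = d ∨ a = d ∧ b = c := by
  rw [← points_injective.eq_iff, points_pair, points_pair, Set.pair_eq_pair_iff]

theorem opair_inj {a b c d : ASet} : opair a b = opair c d ↔ a = c ∧ b = d := by
  simp only [opair, AS.pair_eq_pair_iff]
  grind

theorem continuous_pair : Continuous fun p : ASet × ASet => pair p.1 p.2 := by
  rw [isEmbedding_F.continuous_iff]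
  refine continuous_pi fun n => ?_
  cases n with
  | zero => exact continuous_const
  | succ n =>
    have h : Continuous fun q : HF n × HF n => (HF.ofElems {q.1, q.2} : HF (n + 1)) :=
      continuous_of_discreteTopology
    exact h.comp (((continuous_F n).comp continuous_fst).prodMk
      ((continuous_F n).comp continuous_snd))

theorem continuous_opair : Continuous fun p : ASet × ASet => opair p.1 p.2 :=
  continuous_pair.comp ((continuous_pair.comp (continuous_fst.prodMk continuous_fst)).prodMk
    continuous_pair)

theorem isClosed_setOf_opair_mem (R : ASet) : IsClosed {p : ASet × ASet | opair p.1 p.2 ∈ R} :=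
  (isClosed_points R).preimage continuous_opair

/-- The set of the theory that represents a binary relation. -/
def ofRel (C : Set (ASet × ASet)) : ASet := ofSet ((fun p : ASet × ASet => opair p.1 p.2) '' C)

theorem mem_ofRel {C : Set (ASet × ASet)} (hC : IsClosed C) {z : ASet} :
    z ∈ ofRel C ↔ ∃ a b, (a, b) ∈ C ∧ opair a b = z := by
  rw [ofRel, mem_ofSet (hC.isCompact.image continuous_opair).isClosed]
  simp

theorem opair_mem_ofRel {C : Set (ASet × ASet)} (hC : IsClosed C) {a b : ASet} :
    opair a b ∈ ofRel C ↔ (a, b) ∈ C := by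
  rw [mem_ofRel hC]
  simp [opair_inj]

theorem isRelation_ofRel {C : Set (ASet × ASet)} (hC : IsClosed C) {A B : ASet}
    (h : ∀ a b, (a, b) ∈ C → a ∈ A ∧ b ∈ B) : IsRelation (ofRel C) A B := by
  intro z hz
  obtain ⟨a, b, hab, rfl⟩ := (mem_ofRel hC).1 hz
  exact ⟨a, b, (h a b hab).1, (h a b hab).2, rfl⟩

theorem IsRelation.mem {R A B a b : ASet} (hR : IsRelation R A B) (h : opair a b ∈ R) :
    a ∈ A ∧ b ∈ B := by
  obtain ⟨a', b', ha, hb, e⟩ := hR _ h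
  obtain ⟨rfl, rfl⟩ := opair_inj.1 e
  exact ⟨ha, hb⟩

/-- A function of the theory is given by a continuous map. -/
theorem IsFunction.exists_continuousOn {f A B : ASet} (hf : IsFunction f A B) :
    ∃ φ : ASet → ASet, ContinuousOn φ (points A) ∧ MapsTo φ (points A) (points B) ∧
      ∀ a b, opair a b ∈ f ↔ a ∈ A ∧ φ a = b := by
  classical
  obtain ⟨hrel, htot, huniq⟩ := hf
  choose! φ hφB hφ using htot
  refine ⟨φ, ?_, hφB, fun a b => ⟨fun h => ?_, ?_⟩⟩
  -- Closed graph argument: the preimage of a closed set is the projection of a compact part of the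
  -- graph.
  · rw [continuousOn_iff_continuous_domRestrict]
    refine continuous_iff_isClosed.2 fun S hS => ?_
    have : (points A).domRestrict φ ⁻¹' S = (↑) ⁻¹' (Prod.fst ''
        ({p : ASet × ASet | opair p.1 p.2 ∈ f} ∩ Prod.snd ⁻¹' S)) := by
      ext ⟨x, hx⟩
      simp only [mem_preimage, domRestrict_apply, mem_image, mem_inter_iff, mem_ofPred_eq, Prod.exists,
        exists_and_right, exists_eq_right]
      refine ⟨fun h => ⟨φ x, hφ x hx, h⟩, ?_⟩
      rintro ⟨b, hb, hbS⟩
      exact (huniq x _ _ (hφ x hx) hb) ▸ hbS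
    rw [this]
    exact (((isClosed_setOf_opair_mem f).inter (hS.preimage continuous_snd)).isCompact.image
      continuous_fst).isClosed.preimage continuous_subtype_val
  · have ha := (hrel.mem h).1
    exact ⟨ha, huniq a _ _ (hφ a ha) h⟩
  · rintro ⟨ha, rfl⟩
    exact hφ a ha

theorem exists_isFunction {φ : ASet → ASet} {A B : ASet} (hc : ContinuousOn φ (points A))
    (hm : MapsTo φ (points A) (points B)) :
    ∃ f, IsFunction f A B ∧ ∀ a b, opair a b ∈ f ↔ a ∈ A ∧ φ a = b := by
  have hC : IsClosed ((fun a => (a, φ a)) '' points A) :=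
    ((isClosed_points A).isCompact.image_of_continuousOn (continuousOn_id.prodMk hc)).isClosed
  have hmem : ∀ a b, opair a b ∈ ofRel ((fun a => (a, φ a)) '' points A) ↔ a ∈ A ∧ φ a = b := by
    intro a b
    rw [opair_mem_ofRel hC]
    simp only [mem_image, mem_points, Prod.mk.injEq]
    grind
  refine ⟨_, ⟨isRelation_ofRel hC ?_, fun a ha => ⟨φ a, hm ha, (hmem _ _).2 ⟨ha, rfl⟩⟩, ?_⟩, hmem⟩
  · rintro _ _ ⟨a, ha, e⟩
    obtain ⟨rfl, rfl⟩ := Prod.mk.inj e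
    exact ⟨ha, hm ha⟩
  · intro a b b' h h'
    rw [← ((hmem _ _).1 h).2, ← ((hmem _ _).1 h').2]

/-- The closed set `A` embeds topologically into `B`. -/
def Embeds (A B : Set ASet) : Prop :=
  ∃ φ : ASet → ASet, ContinuousOn φ A ∧ MapsTo φ A B ∧ InjOn φ A

theorem cardLE_iff {A B : ASet} : CardLE A B ↔ Embeds (points A) (points B) := by
  constructor
  · rintro ⟨f, hf, hinj⟩
    obtain ⟨φ, hc, hm, h⟩ := hf.exists_continuousOn
    refine ⟨φ, hc, hm, fun a ha a' ha' e => ?_⟩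
    exact hinj a a' (φ a) ((h _ _).2 ⟨ha, rfl⟩) ((h _ _).2 ⟨ha', e.symm⟩)
  · rintro ⟨φ, hc, hm, hinj⟩
    obtain ⟨f, hf, h⟩ := exists_isFunction hc hm
    refine ⟨f, hf, fun a a' b hab hab' => ?_⟩
    rw [h] at hab hab'
    exact hinj hab.1 hab'.1 (hab.2.trans hab'.2.symm)

theorem isDerivedSet_iff {X Y : ASet} : IsDerivedSet Y X ↔ points Y = derivedSet (points X) := by
  have key : ∀ x, IsAccPoint x X ↔ x ∈ derivedSet (points X) := by
    intro x
    rw [mem_derivedSet, accPt_iff_nhds]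
    constructor
    · intro h U hU
      obtain ⟨n, hn⟩ := exists_cell_subset hU
      obtain ⟨y, hyX, hyx, hy⟩ := h n
      exact ⟨y, ⟨hn hy, hyX⟩, hyx⟩
    · intro h n
      obtain ⟨y, hy, hyx⟩ := h _ (cell_mem_nhds n x)
      exact ⟨y, hy.2, hyx, hy.1⟩
  simp only [IsDerivedSet, key, Set.ext_iff, mem_points]

theorem isEmptySet_iff {A : ASet} : IsEmptySet A ↔ points A = ∅ := by
  simp [IsEmptySet, Set.eq_empty_iff_forall_notMem, mem_points]

theorem exists_initialSeg_of_strictMono {X Y : Type*} [LinearOrder X] [LinearOrder Y] {g : X → Y}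
    (hg : StrictMono g) (hr : IsLowerSet (range g)) : ∃ f : X ≤i Y, ∀ x, f x = g x :=
  ⟨⟨⟨⟨g, hg.injective⟩, hg.lt_iff_lt⟩, fun a _ hb => hr (le_of_lt hb) (mem_range_self a)⟩,
    fun _ => rfl⟩

/-! ### Ordinals as compact well-orders; comparison by order type -/

namespace WOSet

/-- The elements of an ordinal. -/
@[ext]
structure El (α : WOSet) : Type where
  val : ASet
  mem : val ∈ α.carrier

variable {α β : WOSet}

theorem mem_carrier_of_mem_rel {a b : ASet} (h : opair a b ∈ α.rel) :
    a ∈ α.carrier ∧ b ∈ α.carrier :=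
  α.wellOrders.1.1.mem h

instance : TopologicalSpace α.El := TopologicalSpace.induced El.val inferInstance

theorem isClosedEmbedding_val : IsClosedEmbedding (El.val : α.El → ASet) := by
  refine ⟨⟨⟨rfl⟩, fun _ _ => El.ext⟩, ?_⟩
  convert isClosed_points α.carrier
  exact Set.ext fun x => ⟨by rintro ⟨y, rfl⟩; exact y.2, fun h => ⟨⟨x, h⟩, rfl⟩⟩

theorem continuous_val : Continuous (El.val : α.El → ASet) := isClosedEmbedding_val.continuous

instance : CompactSpace α.El := isClosedEmbedding_val.compactSpace

instance : T2Space α.El := isClosedEmbedding_val.isEmbedding.t2Space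

noncomputable instance : LinearOrder α.El where
  le x y := opair x.1 y.1 ∈ α.rel
  le_refl x := or_self_iff.1 (α.wellOrders.1.2.2.2 x.1 x.1 x.2 x.2)
  le_trans _ _ _ h h' := α.wellOrders.1.2.2.1 _ _ _ h h'
  le_antisymm _ _ h h' := El.ext (α.wellOrders.1.2.1 _ _ h h')
  le_total x y := α.wellOrders.1.2.2.2 _ _ x.2 y.2
  toDecidableLE := Classical.decRel _

theorem le_def {x y : α.El} : x ≤ y ↔ opair x.1 y.1 ∈ α.rel := Iff.rfl

instance : OrderClosedTopology α.El where
  isClosed_le' := (isClosed_setOf_opair_mem α.rel).preimage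
    ((continuous_val.comp continuous_fst).prodMk (continuous_val.comp continuous_snd))

/-- Points are upward isolated. -/
theorem exists_cell_forall_le (x : α.El) :
    ∃ n, ∀ y : α.El, y.1 ∈ cell n x.1 → y ≤ x := by
  obtain ⟨n, hn⟩ := α.wellOrders.2.2 x.1 x.2
  refine ⟨n, fun y hy => ?_⟩
  by_contra h
  exact hn y.1 y.2 (fun e => h (El.ext e).le) hy (le_def.1 (not_le.1 h).le)

theorem isOpen_Iic (x : α.El) : IsOpen (Iic x) := by
  rw [isOpen_iff_mem_nhds]
  intro y hy
  obtain ⟨n, hn⟩ := exists_cell_forall_le y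
  exact mem_of_superset (continuous_val.continuousAt (cell_mem_nhds n y.1))
    fun z hz => (hn z hz).trans hy

/-- Minima of arbitrary subsets come from their closures: if `m` is least in the compact closure of
`S`, the open neighborhood `Iic m` of `m` must meet `S`, and it can do so only in `m`. -/
instance : WellFoundedLT α.El := by
  refine ⟨WellFounded.wellFounded_iff_has_min.2 fun S hS => ?_⟩
  obtain ⟨m, hm, hle⟩ := isClosed_closure.isCompact.exists_isLeast hS.closure
  obtain ⟨y, hy, hyS⟩ := mem_closure_iff_nhds.1 hm _ ((isOpen_Iic m).mem_nhds self_mem_Iic)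
  obtain rfl : y = m := le_antisymm hy (hle (subset_closure hyS))
  exact ⟨y, hyS, fun x hx => not_lt.2 (hle (subset_closure hx))⟩

/-- The order type of an ordinal. -/
noncomputable def type (α : WOSet) : Ordinal.{0} := Ordinal.type (α := α.El) (· < ·)

/-- An order isomorphism onto an initial segment is continuous. -/
theorem continuous_initialSeg (f : α.El ≤i β.El) : Continuous f := by
  rw [continuous_iff_continuousAt]
  intro x U hU
  obtain ⟨V, hVU, hV, hxV⟩ := mem_nhds_iff.1 hU
  rw [mem_map]
  -- The largest point of this compact set, if there is one, is some `f z` with `z < x`; then the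
  -- open interval from `z` exclusive to `x` inclusive is mapped into `V`.
  have hK : IsCompact (Iic (f x) \ V) := (isClosed_Iic.sdiff hV).isCompact
  rcases (Iic (f x) \ V).eq_empty_or_nonempty with h | h
  · refine mem_of_superset ((isOpen_Iic x).mem_nhds self_mem_Iic) fun y hy => hVU ?_
    by_contra hyV
    exact (h ▸ (⟨f.monotone hy, hyV⟩ : f y ∈ Iic (f x) \ V) : f y ∈ (∅ : Set β.El))
  · obtain ⟨m, hm, hmax⟩ := hK.exists_isGreatest h
    have hmx : m < f x := lt_of_le_of_ne hm.1 (by rintro rfl; exact hm.2 hxV)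
    obtain ⟨z, rfl⟩ := f.mem_range_of_rel hmx
    have hzx : z < x := f.lt_iff_lt.1 hmx
    refine mem_of_superset (((isOpen_Iic x).inter isOpen_Ioi).mem_nhds ⟨self_mem_Iic, hzx⟩)
      fun y hy => hVU ?_
    by_contra hyV
    exact (hmax ⟨f.monotone hy.1, hyV⟩).not_gt (f.strictMono hy.2)

theorem exists_initialSeg_of_isIsomorphism {S f : ASet} (hS : IsInitialSegment S β.carrier β.rel)
    (hf : IsIsomorphism f α.carrier α.rel S β.rel) :
    ∃ g : α.El ≤i β.El, ∀ b : β.El, b ∈ range g ↔ b.1 ∈ S := by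
  obtain ⟨⟨⟨hfun, hinj⟩, hsurj⟩, hmono⟩ := hf
  obtain ⟨φ, -, hm, h⟩ := hfun.exists_continuousOn
  have hφ : ∀ x : α.El, opair x.1 (φ x.1) ∈ f := fun x => (h _ _).2 ⟨x.2, rfl⟩
  let g : α.El → β.El := fun x => ⟨φ x.1, hS.1 _ (hm x.2)⟩
  have hg : StrictMono g := by
    refine Monotone.strictMono_of_injective (fun x y hxy => ?_) fun x y hxy => ?_
    · exact hmono _ _ _ _ (hφ x) (hφ y) hxy
    · have e : φ x.1 = φ y.1 := congrArg El.val hxy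
      exact El.ext (hinj _ _ _ (hφ x) (e ▸ hφ y))
  have hr : ∀ b : β.El, b ∈ range g ↔ b.1 ∈ S := by
    intro b
    refine ⟨by rintro ⟨x, rfl⟩; exact hm x.2, fun hb => ?_⟩
    obtain ⟨a, ha, hab⟩ := hsurj _ hb
    exact ⟨⟨a, ha⟩, El.ext ((h _ _).1 hab).2⟩
  obtain ⟨i, hi⟩ := exists_initialSeg_of_strictMono hg fun b a hab hb =>
    (hr a).2 (hS.2 _ _ ((hr b).1 hb) a.2 hab)
  refine ⟨i, fun b => ?_⟩
  rw [← hr, show (i : α.El → β.El) = g from funext hi]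

/-- Continuity of `g` on a compact space makes its range and its graph closed, so both are sets of
the theory. -/
theorem exists_isIsomorphism_of_initialSeg (g : α.El ≤i β.El) :
    ∃ S f, IsInitialSegment S β.carrier β.rel ∧ IsIsomorphism f α.carrier α.rel S β.rel ∧
      ∀ b : β.El, b ∈ range g ↔ b.1 ∈ S := by
  classical
  have hc := continuous_initialSeg g
  have hcl : IsClosed (El.val '' range g : Set ASet) :=
    ((isCompact_range hc).image continuous_val).isClosed
  let S : ASet := ofSet (El.val '' range g)
  have hS : ∀ b : ASet, b ∈ S ↔ ∃ x, (g x).1 = b := by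
    intro b
    rw [mem_ofSet hcl, ← range_comp]
    exact Iff.rfl
  let φ : ASet → ASet := fun x => if hx : x ∈ α.carrier then (g ⟨x, hx⟩).1 else x
  have hφ : ∀ x : α.El, φ x.1 = (g x).1 := fun x => dif_pos x.2
  have hφc : ContinuousOn φ (points α.carrier) := by
    rw [continuousOn_iff_continuous_domRestrict]
    let i : points α.carrier → α.El := fun x => ⟨x.1, x.2⟩
    have hi : Continuous i := isClosedEmbedding_val.isEmbedding.continuous_iff.2
      continuous_subtype_val
    have : (points α.carrier).domRestrict φ = fun x => (g (i x)).1 := funext fun x => hφ (i x)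
    rw [this]
    exact continuous_val.comp (hc.comp hi)
  obtain ⟨f, hf, hmem⟩ := exists_isFunction (B := S) hφc
    (fun x hx => (hS _).2 ⟨⟨x, hx⟩, (hφ ⟨x, hx⟩).symm⟩)
  have hmem' : ∀ a b, opair a b ∈ f ↔ ∃ x : α.El, x.1 = a ∧ (g x).1 = b := by
    intro a b
    rw [hmem]
    constructor
    · rintro ⟨ha, rfl⟩
      exact ⟨⟨a, ha⟩, rfl, (hφ ⟨a, ha⟩).symm⟩
    · rintro ⟨x, rfl, rfl⟩
      exact ⟨x.2, hφ x⟩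
  refine ⟨S, f, ⟨?_, ?_⟩, ⟨⟨⟨hf, ?_⟩, ?_⟩, ?_⟩, ?_⟩
  · intro b hb
    obtain ⟨x, rfl⟩ := (hS b).1 hb
    exact (g x).2
  · intro x y hx hy hyx
    obtain ⟨a, rfl⟩ := (hS x).1 hx
    have hle : @LE.le β.El _ ⟨y, hy⟩ (g a) := hyx
    obtain ⟨b, hb⟩ := g.mem_range_of_le hle
    exact (hS y).2 ⟨b, congrArg El.val hb⟩
  · intro a a' b h h'
    obtain ⟨x, rfl, rfl⟩ := (hmem' _ _).1 h
    obtain ⟨y, rfl, e⟩ := (hmem' _ _).1 h'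
    rw [g.injective (El.ext e)]
  · intro b hb
    obtain ⟨x, rfl⟩ := (hS b).1 hb
    exact ⟨x.1, x.2, (hmem' _ _).2 ⟨x, rfl, rfl⟩⟩
  · intro x₁ x₂ y₁ y₂ h₁ h₂ h
    obtain ⟨x, rfl, rfl⟩ := (hmem' _ _).1 h₁
    obtain ⟨y, rfl, rfl⟩ := (hmem' _ _).1 h₂
    exact g.monotone (show x ≤ y from h)
  · intro b
    rw [hS]
    exact ⟨fun ⟨x, hx⟩ => ⟨x, congrArg El.val hx⟩, fun ⟨x, hx⟩ => ⟨x, El.ext hx⟩⟩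

theorem ordLE_iff : OrdLE α β ↔ α.type ≤ β.type := by
  rw [type, type, Ordinal.type_le_iff]
  constructor
  · rintro ⟨S, f, hS, hf⟩
    exact ⟨(exists_initialSeg_of_isIsomorphism hS hf).choose⟩
  · rintro ⟨g⟩
    obtain ⟨S, f, hS, hf, -⟩ := exists_isIsomorphism_of_initialSeg g
    exact ⟨S, f, hS, hf⟩

theorem ordEq_iff : OrdEq α β ↔ α.type = β.type := by
  rw [OrdEq, ordLE_iff, ordLE_iff, le_antisymm_iff]

theorem ordLT_iff : OrdLT α β ↔ α.type < β.type := by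
  constructor
  · rintro ⟨S, f, hS, hne, hf⟩
    obtain ⟨g, hg⟩ := exists_initialSeg_of_isIsomorphism hS hf
    rw [type, type, Ordinal.type_lt_iff]
    refine ⟨g.toPrincipalSeg fun hsurj => hne (eq_of_mem_iff fun x => ⟨hS.1 x, fun hx => ?_⟩)⟩
    exact (hg ⟨x, hx⟩).1 (hsurj _)
  · intro h
    rw [type, type, Ordinal.type_lt_iff] at h
    obtain ⟨g⟩ := h
    obtain ⟨S, f, hS, hf, hr⟩ := exists_isIsomorphism_of_initialSeg (g : α.El ≤i β.El)
    refine ⟨S, f, hS, ?_, hf⟩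
    rintro rfl
    have := (hr g.top).2 g.top.2
    obtain ⟨x, hx⟩ := this
    exact (g.lt_top x).ne hx

theorem isEmptySet_carrier_iff : IsEmptySet α.carrier ↔ α.type = 0 := by
  rw [type, Ordinal.type_eq_zero_iff_isEmpty]
  exact ⟨fun h => ⟨fun x => h x.1 x.2⟩, fun h x hx => h.elim ⟨x, hx⟩⟩

end WOSet

/-- The restriction of a well-ordering to a smaller set. -/
theorem WellOrders.restrict {R A S : ASet} (h : WellOrders R A) (hS : S ⊆ A) :
    ∃ R', WellOrders R' S ∧ ∀ x y, opair x y ∈ R' ↔ opair x y ∈ R ∧ x ∈ S ∧ y ∈ S := by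
  have hC : IsClosed ({p : ASet × ASet | opair p.1 p.2 ∈ R} ∩ points S ×ˢ points S) :=
    (isClosed_setOf_opair_mem R).inter ((isClosed_points S).prod (isClosed_points S))
  have hmem : ∀ x y, opair x y ∈ ofRel ({p : ASet × ASet | opair p.1 p.2 ∈ R} ∩
      points S ×ˢ points S) ↔ opair x y ∈ R ∧ x ∈ S ∧ y ∈ S := fun x y => opair_mem_ofRel hC
  refine ⟨_, ⟨⟨isRelation_ofRel hC fun a b hab => hab.2, ?_, ?_, ?_⟩, ?_, ?_⟩, hmem⟩
  all_goals simp only [hmem]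
  · exact fun x y hxy hyx => h.1.2.1 x y hxy.1 hyx.1
  · exact fun x y z hxy hyz => ⟨h.1.2.2.1 x y z hxy.1 hyz.1, hxy.2.1, hyz.2.2⟩
  · intro x y hx hy
    exact (h.1.2.2.2 x y (hS x hx) (hS y hy)).imp (fun h => ⟨h, hx, hy⟩) fun h => ⟨h, hy, hx⟩
  · intro B hB hne
    obtain ⟨m, hm, hle⟩ := h.2.1 B (fun x hx => hS x (hB x hx)) hne
    exact ⟨m, hm, fun x hx => ⟨hle x hx, hB m hm, hB x hx⟩⟩
  · intro x hx
    obtain ⟨n, hn⟩ := h.2.2 x (hS x hx)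
    exact ⟨n, fun y hy hyx hxy hr => hn y (hS y hy) hyx hxy hr.1⟩

/-! ### Positions of elements, realized order types, successors -/

namespace WOSet

variable {α β : WOSet}

theorem exists_restrict (α : WOSet) {S : ASet} (hS : S ⊆ α.carrier) :
    ∃ γ : WOSet, γ.carrier = S ∧
      ∀ x y, opair x y ∈ γ.rel ↔ opair x y ∈ α.rel ∧ x ∈ S ∧ y ∈ S := by
  obtain ⟨R, hR, h⟩ := α.wellOrders.restrict hS
  exact ⟨⟨S, R, hR⟩, rfl, h⟩

/-- The inclusion of an initial segment. -/
theorem exists_initialSeg_of_subset {γ : WOSet} (hsub : γ.carrier ⊆ α.carrier)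
    (hrel : ∀ x y, x ∈ γ.carrier → y ∈ γ.carrier → (opair x y ∈ γ.rel ↔ opair x y ∈ α.rel))
    (hinit : ∀ x y, x ∈ γ.carrier → opair y x ∈ α.rel → y ∈ γ.carrier) :
    ∃ g : γ.El ≤i α.El, ∀ x, (g x).1 = x.1 := by
  let g : γ.El → α.El := fun x => ⟨x.1, hsub _ x.2⟩
  have hg : StrictMono g := by
    refine Monotone.strictMono_of_injective (fun x y hxy => ?_) fun x y hxy => ?_
    · exact (hrel _ _ x.2 y.2).1 hxy
    · exact El.ext (congrArg (fun z : α.El => z.1) hxy)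
  obtain ⟨i, hi⟩ := exists_initialSeg_of_strictMono hg (by
    rintro _ b hab ⟨a, rfl⟩
    exact ⟨⟨b.1, hinit _ _ a.2 hab⟩, rfl⟩)
  exact ⟨i, fun x => congrArg El.val (hi x)⟩

/-- The position of an element. -/
noncomputable def idx (x : α.El) : Ordinal.{0} := Ordinal.typein (α := α.El) (· < ·) x

theorem idx_lt_idx {x y : α.El} : idx x < idx y ↔ x < y :=
  Ordinal.typein_lt_typein (α := α.El) (· < ·)

theorem idx_le_idx {x y : α.El} : idx x ≤ idx y ↔ x ≤ y := by
  rw [← not_lt, idx_lt_idx, not_lt]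

theorem lt_type_iff {o : Ordinal.{0}} : o < α.type ↔ ∃ x : α.El, idx x = o := by
  rw [type, ← Ordinal.mem_range_typein_iff]
  exact Iff.rfl

theorem idx_lt_type (x : α.El) : idx x < α.type := lt_type_iff.2 ⟨x, rfl⟩

theorem idx_initialSeg (g : α.El ≤i β.El) (x : α.El) : idx (g x) = idx x :=
  Ordinal.typein_apply g x

theorem exists_idx_eq_of_le {x : α.El} {o : Ordinal.{0}} (h : o ≤ idx x) :
    ∃ y ≤ x, idx y = o := by
  obtain ⟨y, rfl⟩ := lt_type_iff.1 (h.trans_lt (idx_lt_type x))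
  exact ⟨y, idx_le_idx.1 h, rfl⟩

theorem type_eq_idx_add_one {m : α.El} (hm : ∀ x, x ≤ m) : α.type = idx m + 1 := by
  refine eq_of_forall_lt_iff fun o => ?_
  rw [Order.lt_add_one_iff, lt_type_iff]
  refine ⟨fun ⟨x, hx⟩ => hx ▸ idx_le_idx.2 (hm x), fun h => ?_⟩
  obtain ⟨y, -, hy⟩ := exists_idx_eq_of_le h
  exact ⟨y, hy⟩

theorem exists_isMax (h : α.type ≠ 0) : ∃ m : α.El, ∀ x, x ≤ m := by
  have : Nonempty α.El := by
    rw [← not_isEmpty_iff, ← Ordinal.type_eq_zero_iff_isEmpty (r := ((· < ·) : α.El → α.El → Prop))]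
    exact h
  obtain ⟨m, -, hm⟩ := isCompact_univ.exists_isGreatest (univ_nonempty (α := α.El))
  exact ⟨m, fun x => hm (mem_univ x)⟩

/-- An ordinal is empty or has a maximal element. -/
theorem type_eq_zero_or (α : WOSet) : α.type = 0 ∨ ∃ o, α.type = o + 1 := by
  by_cases h : α.type = 0
  · exact .inl h
  · obtain ⟨m, hm⟩ := exists_isMax h
    exact .inr ⟨_, type_eq_idx_add_one hm⟩

theorem exists_of_lowerSet {S : Set α.El} (hS : IsClosed S) (hlow : IsLowerSet S) :
    ∃ γ : WOSet, (∀ x, x ∈ γ.carrier ↔ ∃ h : x ∈ α.carrier, (⟨x, h⟩ : α.El) ∈ S) ∧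
      (∀ x y, x ∈ γ.carrier → y ∈ γ.carrier → (opair x y ∈ γ.rel ↔ opair x y ∈ α.rel)) ∧
      ∀ o, o < γ.type ↔ ∃ x ∈ S, idx x = o := by
  have hcl : IsClosed (El.val '' S : Set ASet) :=
    (hS.isCompact.image continuous_val).isClosed
  have hmem : ∀ x, x ∈ ofSet (El.val '' S) ↔ ∃ h : x ∈ α.carrier, (⟨x, h⟩ : α.El) ∈ S := by
    intro x
    rw [mem_ofSet hcl]
    constructor
    · rintro ⟨y, hy, rfl⟩
      exact ⟨y.2, hy⟩
    · rintro ⟨h, hx⟩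
      exact ⟨_, hx, rfl⟩
  obtain ⟨γ, hγ, hrel⟩ := exists_restrict α (S := ofSet (El.val '' S))
    fun x hx => ((hmem x).1 hx).1
  have hmemγ : ∀ x, x ∈ γ.carrier ↔ ∃ h : x ∈ α.carrier, (⟨x, h⟩ : α.El) ∈ S := hγ ▸ hmem
  have hrel' : ∀ x y, x ∈ γ.carrier → y ∈ γ.carrier → (opair x y ∈ γ.rel ↔ opair x y ∈ α.rel) := by
    intro x y hx hy
    rw [hrel, ← hγ]
    exact ⟨fun h => h.1, fun h => ⟨h, hx, hy⟩⟩
  refine ⟨γ, hmemγ, hrel', fun o => ?_⟩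
  obtain ⟨g, hg⟩ := exists_initialSeg_of_subset (α := α) (γ := γ) (fun x hx => ((hmemγ x).1 hx).1)
    hrel' (fun x y hx hyx => by
      obtain ⟨h, hxS⟩ := (hmemγ x).1 hx
      have hy := (mem_carrier_of_mem_rel hyx).1
      exact (hmemγ y).2 ⟨hy, hlow (show @LE.le α.El _ ⟨y, hy⟩ ⟨x, h⟩ from hyx) hxS⟩)
  rw [lt_type_iff]
  constructor
  · rintro ⟨x, rfl⟩
    obtain ⟨h, hx⟩ := (hmemγ x.1).1 x.2
    refine ⟨g x, ?_, idx_initialSeg g x⟩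
    rwa [show g x = ⟨x.1, h⟩ from El.ext (hg x)]
  · rintro ⟨x, hx, rfl⟩
    have hxγ : x.1 ∈ γ.carrier := (hmemγ x.1).2 ⟨x.2, hx⟩
    refine ⟨⟨x.1, hxγ⟩, ?_⟩
    rw [← idx_initialSeg g, show g ⟨x.1, hxγ⟩ = x from El.ext (hg _)]

theorem exists_type_eq_idx_add_one (x : α.El) : ∃ γ : WOSet, γ.type = idx x + 1 := by
  obtain ⟨γ, -, -, h⟩ := exists_of_lowerSet (isClosed_Iic (a := x)) (isLowerSet_Iic x)
  refine ⟨γ, eq_of_forall_lt_iff fun o => ?_⟩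
  rw [h, Order.lt_add_one_iff]
  refine ⟨fun ⟨y, hy, e⟩ => e ▸ idx_le_idx.2 hy, fun ho => ?_⟩
  obtain ⟨y, hy, e⟩ := exists_idx_eq_of_le ho
  exact ⟨y, hy, e⟩

theorem exists_type_eq_zero (α : WOSet) : ∃ γ : WOSet, γ.type = 0 := by
  obtain ⟨γ, -, -, h⟩ := exists_of_lowerSet (isClosed_empty (X := α.El)) isLowerSet_empty
  refine ⟨γ, ?_⟩
  by_contra h0
  obtain ⟨x, hx, -⟩ := (h 0).1 (pos_iff_ne_zero.2 h0)
  exact hx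

/-- The order types below that of an ordinal which are zero or successors are order types of
ordinals. -/
theorem exists_type_eq {o : Ordinal.{0}} (ho : o = 0 ∨ ∃ p, o = p + 1) (h : o ≤ α.type) :
    ∃ γ : WOSet, γ.type = o := by
  rcases ho with rfl | ⟨p, rfl⟩
  · exact exists_type_eq_zero α
  · obtain ⟨x, rfl⟩ := lt_type_iff.1 (Order.add_one_le_iff.1 h)
    exact exists_type_eq_idx_add_one x

/-- Removing the maximum `m` leaves the order type `idx m`. The delicate point is that `Iio m` must
be closed; if its type is that of an ordinal `α`, it is the continuous image of the compact space
`α.El`. -/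
theorem isSuccessor_iff : IsSuccessor β α ↔ β.type = α.type + 1 := by
  constructor
  · rintro ⟨γ, ⟨⟨m, ⟨hmβ, hmax⟩, hmem⟩, hrel⟩, hγα⟩
    rw [ordEq_iff] at hγα
    rw [type_eq_idx_add_one (m := ⟨m, hmβ⟩) fun x => hmax x.1 x.2, ← hγα]
    congr 1
    obtain ⟨g, hg⟩ := exists_initialSeg_of_subset (α := β) (γ := γ) (fun x hx => ((hmem x).1 hx).1)
      hrel (fun x y hx hyx => by
        refine (hmem y).2 ⟨(mem_carrier_of_mem_rel hyx).1, ?_⟩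
        rintro rfl
        exact ((hmem x).1 hx).2 (β.wellOrders.1.2.1 _ _ (hmax x ((hmem x).1 hx).1) hyx))
    refine eq_of_forall_lt_iff fun o => ?_
    rw [lt_type_iff]
    constructor
    · intro ho
      obtain ⟨y, hy, rfl⟩ := exists_idx_eq_of_le ho.le
      have hyγ : y.1 ∈ γ.carrier := (hmem _).2 ⟨y.2, fun e => ho.ne (congrArg idx (El.ext e))⟩
      refine ⟨⟨y.1, hyγ⟩, ?_⟩
      rw [← idx_initialSeg g, show g ⟨y.1, hyγ⟩ = y from El.ext (hg _)]
    · rintro ⟨x, rfl⟩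
      rw [← idx_initialSeg g, idx_lt_idx]
      refine lt_of_le_of_ne (hmax _ (g x).2) fun e => ?_
      have : (g x).1 = m := congrArg (fun z : β.El => z.1) e
      exact ((hmem x.1).1 x.2).2 ((hg x).symm.trans this)
  · intro h
    obtain ⟨m, hm⟩ := exists_isMax (α := β) (by rw [h]; exact (Order.lt_add_one_iff.2 zero_le).ne')
    have hmα : idx m = α.type := by
      rw [type_eq_idx_add_one hm] at h
      exact Order.add_one_inj.1 h
    obtain ⟨g⟩ : Nonempty (α.El ≤i β.El) := by
      have : α.type ≤ β.type := h ▸ (Order.lt_add_one_iff.2 le_rfl).le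
      rwa [type, type, Ordinal.type_le_iff] at this
    have hr : range g = Iio m := by
      ext y
      rw [mem_Iio, ← idx_lt_idx, hmα, lt_type_iff]
      refine ⟨fun ⟨x, hx⟩ => ⟨x, hx ▸ (idx_initialSeg g x).symm⟩, fun ⟨x, hx⟩ => ⟨x, ?_⟩⟩
      rw [← idx_initialSeg g] at hx
      exact le_antisymm (idx_le_idx.1 hx.le) (idx_le_idx.1 hx.ge)
    obtain ⟨γ, hmem, hrel, ht⟩ := exists_of_lowerSet (α := β)
      (hr ▸ (isCompact_range (continuous_initialSeg g)).isClosed) (isLowerSet_Iio m)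
    refine ⟨γ, ⟨⟨m.1, ⟨m.2, fun x hx => hm ⟨x, hx⟩⟩, fun x => ?_⟩, hrel⟩, ?_⟩
    · rw [hmem]
      refine ⟨fun ⟨h, hx⟩ => ⟨h, fun e => ne_of_lt hx (El.ext e)⟩, fun ⟨h, hx⟩ => ⟨h, ?_⟩⟩
      exact lt_of_le_of_ne (hm _) fun e => hx (congrArg (fun z : β.El => z.1) e)
    · rw [ordEq_iff, ← hmα]
      refine eq_of_forall_lt_iff fun o => ?_
      rw [ht]
      refine ⟨fun ⟨y, hy, e⟩ => e ▸ idx_lt_idx.2 hy, fun ho => ?_⟩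
      obtain ⟨y, hy, rfl⟩ := exists_idx_eq_of_le ho.le
      exact ⟨y, idx_lt_idx.1 ho, rfl⟩

end WOSet
instance : Inhabited ASet := ⟨ofSet ∅⟩

/-! ### Iterated derived sets and the construction of embeddings -/

section Derived

variable {W : Type*} [LinearOrder W] [WellFoundedLT W] {A B : Set ASet} {v w : W} {x : ASet}

/-- The iterated derived sets of `A`, indexed by a well-ordered type; limits index intersections
that are not derived once more. -/
noncomputable def derived {W : Type*} [LinearOrder W] [WellFoundedLT W] (A : Set ASet)
    (w : W) : Set ASet :=
  A ∩ ⋂ v : Iio w, derivedSet (derived A v.1)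
termination_by (wellFounded_lt (α := W)).wrap w
decreasing_by exact v.2

theorem mem_derived : x ∈ derived A w ↔ x ∈ A ∧ ∀ v < w, x ∈ derivedSet (derived A v) := by
  rw [derived]
  simp

theorem derived_subset : derived A w ⊆ A := fun _ hx => (mem_derived.1 hx).1

theorem derived_subset_derivedSet (h : v < w) : derived A w ⊆ derivedSet (derived A v) :=
  fun _ hx => (mem_derived.1 hx).2 v h

theorem isClosed_derived (hA : IsClosed A) (w : W) : IsClosed (derived A w) := by
  rw [derived]
  exact hA.inter (isClosed_iInter fun _ => isClosed_derivedSet _)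

theorem derivedSet_derived_subset (hA : IsClosed A) (w : W) :
    derivedSet (derived A w) ⊆ derived A w :=
  (isClosed_iff_derivedSet_subset _).1 (isClosed_derived hA w)

theorem derived_antitone (hA : IsClosed A) : Antitone (derived A : W → Set ASet) := by
  intro v w h
  rcases h.eq_or_lt with rfl | h
  · exact le_rfl
  · exact (derived_subset_derivedSet h).trans (derivedSet_derived_subset hA v)

theorem derived_mono (h : A ⊆ B) (w : W) : derived A w ⊆ derived B w := by
  induction w using WellFoundedLT.induction with
  | ind w ih =>
    intro x hx
    rw [mem_derived] at hx ⊢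
    exact ⟨h hx.1, fun v hv => derivedSet_mono _ _ (ih v hv) (hx.2 v hv)⟩

theorem mem_derivedSet_iff_cell {S : Set ASet} :
    x ∈ derivedSet S ↔ ∀ n, ∃ y ∈ S, y ≠ x ∧ y ∈ cell n x := by
  rw [mem_derivedSet, accPt_iff_nhds]
  constructor
  · intro h n
    obtain ⟨y, hy, hyx⟩ := h _ (cell_mem_nhds n x)
    exact ⟨y, hy.2, hyx, hy.1⟩
  · intro h U hU
    obtain ⟨n, hn⟩ := exists_cell_subset hU
    obtain ⟨y, hyS, hyx, hy⟩ := h n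
    exact ⟨y, ⟨hn hy, hyS⟩, hyx⟩

theorem mapsTo_derivedSet {S T : Set ASet} {φ : ASet → ASet} (hx : x ∈ S)
    (hc : ContinuousOn φ S) (hinj : InjOn φ S) {S' : Set ASet} (hS' : S' ⊆ S)
    (hm : MapsTo φ S' T) (h : x ∈ derivedSet S') : φ x ∈ derivedSet T := by
  rw [mem_derivedSet, accPt_iff_nhds] at h ⊢
  intro U hU
  obtain ⟨V, hV, hVU⟩ := mem_nhdsWithin_iff_exists_mem_nhds_inter.1 (hc x hx hU)
  obtain ⟨y, ⟨hyV, hyS⟩, hyx⟩ := h V hV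
  exact ⟨φ y, ⟨hVU ⟨hyV, hS' hyS⟩, hm hyS⟩, fun e => hyx (hinj (hS' hyS) hx e)⟩

theorem mapsTo_derived {φ : ASet → ASet} (hc : ContinuousOn φ A) (hm : MapsTo φ A B)
    (hinj : InjOn φ A) (w : W) : MapsTo φ (derived A w) (derived B w) := by
  induction w using WellFoundedLT.induction with
  | ind w ih =>
    intro x hx
    rw [mem_derived] at hx ⊢
    exact ⟨hm hx.1, fun v hv =>
      mapsTo_derivedSet hx.1 hc hinj derived_subset (ih v hv) (hx.2 v hv)⟩

/-- A sequence of points of prescribed ranks that converges to a point of higher rank. -/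
theorem exists_seq_of_mem_derived {q : ASet} (hq : q ∈ derived B w) (n : ℕ) (v : ℕ → W)
    (hv : ∀ j, v j < w) : ∃ (Q : ℕ → ASet) (M : ℕ → ℕ), StrictMono M ∧ M 0 = n ∧
      ∀ j, Q j ∈ derived B (v j) ∧ Q j ∈ cell (M j) q ∧ Q j ∉ cell (M (j + 1)) q := by
  have step : ∀ j m, ∃ m', m < m' ∧ ∃ z, z ∈ derived B (v j) ∧ z ∈ cell m q ∧ z ∉ cell m' q := by
    intro j m
    obtain ⟨z, hz, hzq, hzm⟩ :=
      mem_derivedSet_iff_cell.1 (derived_subset_derivedSet (hv j) hq) m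
    have : ∃ k, z ∉ cell k q := by
      by_contra! h
      exact hzq (by simpa [iInter_cell] using mem_iInter.2 h)
    obtain ⟨k, hk⟩ := this
    exact ⟨max (m + 1) k, (Nat.lt_succ_self m).trans_le (le_max_left _ _), z, hz, hzm,
      fun h => hk (cell_anti q (le_max_right _ _) h)⟩
  choose m' hm' z hz using step
  let M : ℕ → ℕ := fun j => Nat.rec n (fun j m => m' j m) j
  exact ⟨fun j => z j (M j), M, strictMono_nat_of_lt_succ fun j => hm' j (M j), rfl,
    fun j => hz j (M j)⟩

/-- Away from `p`, the set `A` splits into disjoint clopen pieces, each with at most one point of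
some rank `v < w`. Near `q` there are points of all these ranks, so by induction the pieces embed
into disjoint shells around `q`. The shells shrink to `q` as the pieces shrink to `p`, so sending
`p` to `q` is continuous. The target cell is part of the claim because the induction needs it to
stay inside a shell. -/
theorem embeds_of_derived_subset_singleton (w : W) : ∀ (A : Set ASet) (p : ASet),
    derived A w ⊆ {p} → ∀ (B : Set ASet) (q : ASet), q ∈ derived B w → ∀ n,
      Embeds A (B ∩ cell n q) := by
  classical
  induction w using WellFoundedLT.induction with
  | ind w ih =>
  intro A p hA B q hq n
  let piece : (Σ k, HF k) → Set ASet := fun c => A ∩ {x | x.F c.1 = c.2}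
  -- Good cells: they exclude `p`, and the induction hypothesis applies to their part of `A`.
  let G : (Σ k, HF k) → Prop := fun c =>
    p.F c.1 ≠ c.2 ∧ ∃ v < w, ∃ y, derived (piece c) v ⊆ {y}
  have hG : ∀ x ∈ A, x ≠ p → ∃ k, G ⟨k, x.F k⟩ := by
    intro x hx hxp
    have : ∃ v < w, x ∉ derivedSet (derived A v) := by
      by_contra! h
      exact hxp (hA (mem_derived.2 ⟨hx, h⟩))
    obtain ⟨v, hv, hxv⟩ := this
    rw [mem_derivedSet_iff_cell] at hxv
    push Not at hxv
    obtain ⟨k, hk⟩ := hxv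
    obtain ⟨l, hl⟩ : ∃ l, p.F l ≠ x.F l := by
      by_contra! h
      exact hxp (ASet.ext (funext h)).symm
    refine ⟨max k l, fun h => hl (F_eq_of_le (le_max_right k l) h), v, hv, x, fun y hy => ?_⟩
    by_contra hyx
    exact hk y (derived_mono inter_subset_left v hy) hyx
      (F_eq_of_le (le_max_left k l) (derived_subset hy).2)
  by_cases hAp : A ⊆ {p}
  · refine ⟨fun _ => q, continuousOn_const, fun _ _ => ⟨derived_subset hq, rfl⟩, ?_⟩
    exact fun x hx y hy _ => (hAp hx).trans (hAp hy).symm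
  obtain ⟨x₀, hx₀, hx₀p⟩ := not_subset.1 hAp
  obtain ⟨_, -, v₀, hv₀, -⟩ := hG x₀ hx₀ hx₀p
  -- `c x` is the largest good cell around `x`; such cells are equal or disjoint. The default `0` is
  -- never used for points of `A` other than `p`.
  let N : ASet → ℕ := fun x => if h : ∃ k, G ⟨k, x.F k⟩ then Nat.find h else 0
  let c : ASet → Σ k, HF k := fun x => ⟨N x, x.F (N x)⟩
  have hNG : ∀ x ∈ A, x ≠ p → G (c x) := by
    intro x hx hxp
    have h := hG x hx hxp
    have hN : N x = Nat.find h := dif_pos h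
    simp only [c]
    rw [hN]
    exact Nat.find_spec h
  have hNle : ∀ x k, G ⟨k, x.F k⟩ → N x ≤ k := by
    intro x k h
    simp only [N, dif_pos (show ∃ k, G ⟨k, x.F k⟩ from ⟨k, h⟩)]
    exact Nat.find_min' _ h
  have hcell : ∀ x ∈ A, x ≠ p → ∀ y ∈ A, y.F (N x) = x.F (N x) → y ≠ p ∧ c y = c x := by
    intro x hx hxp y hy hyx
    have hyp : y ≠ p := by
      rintro rfl
      exact (hNG x hx hxp).1 hyx
    have h1 : N y ≤ N x := hNle y (N x) (hyx ▸ hNG x hx hxp)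
    have h2 : N x ≤ N y := hNle x (N y) (F_eq_of_le h1 hyx ▸ hNG y hy hyp)
    have h3 : N y = N x := le_antisymm h1 h2
    refine ⟨hyp, ?_⟩
    simp only [c]
    rw [h3, hyx]
  obtain ⟨e, he⟩ := exists_injective_nat (Σ k, HF k)
  have hv : ∀ j, ∃ v < w, ∀ d, e d = j → G d → ∃ y, derived (piece d) v ⊆ {y} := by
    intro j
    by_cases h : ∃ d, e d = j ∧ G d
    · obtain ⟨d, rfl, -, v, hvw, hd⟩ := h
      exact ⟨v, hvw, fun d' hd' _ => he hd' ▸ hd⟩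
    -- An index that numbers no good cell still needs some rank below `w`.
    · exact ⟨v₀, hv₀, fun d hd hGd => (h ⟨d, hd, hGd⟩).elim⟩
  choose v hvw hv using hv
  obtain ⟨Q, M, hM, hM0, hQ⟩ := exists_seq_of_mem_derived hq n v hvw
  have hφ : ∀ d, G d → Embeds (piece d) (B ∩ cell (M (e d + 1)) (Q (e d))) := by
    intro d hd
    obtain ⟨y, hy⟩ := hv (e d) d rfl hd
    exact ih (v (e d)) (hvw _) (piece d) y hy B (Q (e d)) (hQ _).1 _
  choose! φ hφc hφm hφi using hφ
  have hmem : ∀ x ∈ A, x ∈ piece (c x) := fun x hx => ⟨hx, rfl⟩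
  have hin : ∀ x ∈ A, x ≠ p → φ (c x) x ∈ cell (M (e (c x))) q := by
    intro x hx hxp
    have h := (hφm _ (hNG x hx hxp) (hmem x hx)).2
    exact (F_eq_of_le (hM.monotone (Nat.le_succ _)) h).trans (hQ _).2.1
  have hout : ∀ x ∈ A, x ≠ p → φ (c x) x ∉ cell (M (e (c x) + 1)) q := by
    intro x hx hxp h
    exact (hQ _).2.2 ((hφm _ (hNG x hx hxp) (hmem x hx)).2.symm.trans h)
  let f : ASet → ASet := fun x => if x = p then q else φ (c x) x
  have hfp : f p = q := if_pos rfl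
  have hf : ∀ x, x ≠ p → f x = φ (c x) x := fun x hx => if_neg hx
  refine ⟨f, ?_, ?_, ?_⟩
  · intro x hx
    by_cases hxp : x = p
    · subst hxp
      rw [ContinuousWithinAt, hfp, (nhds_hasBasis q).tendsto_right_iff]
      intro m _
      -- Only finitely many cells have a number below `m`. A point agreeing with `p` up to their
      -- greatest level `K` lies in no good one among them, so its image is in `cell m q`.
      have hfin : {d : Σ k, HF k | e d < m}.Finite := (finite_Iio m).preimage he.injOn
      obtain ⟨K, hK⟩ := (hfin.image Sigma.fst).bddAbove
      filter_upwards [mem_nhdsWithin_of_mem_nhds (cell_mem_nhds K x), self_mem_nhdsWithin]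
        with y hy hyA
      by_cases hyx : y = x
      · rw [hyx, hfp]
        exact mem_cell_self m q
      · rw [hf y hyx]
        refine cell_anti q ?_ (hin y hyA hyx)
        refine le_trans ?_ hM.le_apply
        by_contra! h
        exact (hNG y hyA hyx).1 (F_eq_of_le (hK (mem_image_of_mem _ h)) hy).symm
    · have hcont : ContinuousWithinAt (φ (c x)) A x :=
        (continuousWithinAt_inter (cell_mem_nhds (N x) x)).1
          (hφc _ (hNG x hx hxp) x (hmem x hx))
      refine hcont.congr_of_eventuallyEq ?_ (hf x hxp)
      filter_upwards [mem_nhdsWithin_of_mem_nhds (cell_mem_nhds (N x) x), self_mem_nhdsWithin]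
        with y hy hyA
      obtain ⟨hyp, hyc⟩ := hcell x hx hxp y hyA hy
      rw [hf y hyp, hyc]
  · intro x hx
    by_cases hxp : x = p
    · rw [hxp, hfp]
      exact ⟨derived_subset hq, mem_cell_self n q⟩
    · rw [hf x hxp]
      exact ⟨(hφm _ (hNG x hx hxp) (hmem x hx)).1,
        cell_anti q (hM0 ▸ hM.monotone (Nat.zero_le _)) (hin x hx hxp)⟩
  · have hne : ∀ x ∈ A, x ≠ p → f x ≠ q := by
      intro x hx hxp h
      rw [hf x hxp] at h
      exact hout x hx hxp (by rw [h]; exact mem_cell_self _ q)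
    have hlt : ∀ x ∈ A, x ≠ p → ∀ y ∈ A, y ≠ p → f x = f y → ¬ e (c x) < e (c y) := by
      intro x hx hxp y hy hyp h hlt
      rw [hf x hxp, hf y hyp] at h
      exact hout x hx hxp (h ▸ cell_anti q (hM.monotone hlt) (hin y hy hyp))
    intro x hx y hy hxy
    by_cases hxp : x = p
    · by_contra hyx
      exact hne y hy (fun h => hyx (hxp.trans h.symm)) (by rw [← hxy, hxp, hfp])
    by_cases hyp : y = p
    · exact (hne x hx hxp (by rw [hxy, hyp, hfp])).elim
    have hc : c x = c y := he (le_antisymm (not_lt.1 (hlt y hy hyp x hx hxp hxy.symm))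
      (not_lt.1 (hlt x hx hxp y hy hyp hxy)))
    rw [hf x hxp, hf y hyp, ← hc] at hxy
    exact hφi _ (hNG x hx hxp) (hmem x hx) (hc ▸ hmem y hy) hxy

theorem exists_injOn_F {S : Set ASet} (hS : S.Finite) : ∃ m, ∀ k ≥ m, InjOn (fun x => x.F k) S := by
  induction S, hS using Set.Finite.induction_on with
  | empty => exact ⟨0, fun _ _ => injOn_empty _⟩
  | @insert a S _ hS ih =>
    obtain ⟨m, hm⟩ := ih
    have : ∀ x ∈ S, ∃ k, x ≠ a → x.F k ≠ a.F k := by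
      intro x _
      by_contra! h
      exact (h 0).1 (ASet.ext (funext fun k => (h k).2))
    choose! k hk using this
    obtain ⟨K, hK⟩ := (hS.image k).bddAbove
    have hne : ∀ l ≥ K, ∀ x ∈ S, x.F l = a.F l → x = a := by
      intro l hl x hx h
      by_contra hxa
      exact hk x hx hxa (F_eq_of_le ((hK (mem_image_of_mem _ hx)).trans hl) h)
    refine ⟨max m K, fun l hl x hx y hy hxy => ?_⟩
    rcases mem_insert_iff.1 hx with hxa | hxS <;> rcases mem_insert_iff.1 hy with hya | hyS
    · rw [hxa, hya]
    · rw [hxa] at hxy ⊢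
      exact (hne l (le_of_max_le_right hl) y hyS hxy.symm).symm
    · rw [hya] at hxy ⊢
      exact hne l (le_of_max_le_right hl) x hxS hxy
    · exact hm l (le_of_max_le_left hl) hxS hyS hxy

/-- At a level `m` that separates the points of rank `w` and also their images under `g`, the set
`A` splits into clopen pieces with one such point each, whose target cells are disjoint. -/
theorem embeds_of_injOn_derived (w : W) (hfin : (derived A w).Finite)
    (hne : derived A w = ∅ → A = ∅) {g : ASet → ASet}
    (hg : MapsTo g (derived A w) (derived B w)) (hinj : InjOn g (derived A w)) : Embeds A B := by
  rcases (derived A w).eq_empty_or_nonempty with h | ⟨p₀, hp₀⟩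
  · rw [hne h]
    exact ⟨id, continuousOn_id, mapsTo_empty _ _, injOn_empty _⟩
  obtain ⟨m₁, hm₁⟩ := exists_injOn_F hfin
  obtain ⟨m₂, hm₂⟩ := exists_injOn_F (hfin.image g)
  let m := max m₁ m₂
  replace hm₁ := hm₁ m (le_max_left _ _)
  replace hm₂ := hm₂ m (le_max_right _ _)
  -- Nodes that carry no point of rank `w` are assigned to `p₀`.
  have hr : ∀ h : HF m, ∃ p ∈ derived A w, ∀ p' ∈ derived A w, p'.F m = h → p' = p := by
    intro h
    by_cases hh : ∃ p ∈ derived A w, p.F m = h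
    · obtain ⟨p, hp, rfl⟩ := hh
      exact ⟨p, hp, fun p' hp' e => hm₁ hp' hp e⟩
    · exact ⟨p₀, hp₀, fun p' hp' e => (hh ⟨p', hp', e⟩).elim⟩
  choose r hr hr' using hr
  let piece : ASet → Set ASet := fun p => A ∩ {x | r (x.F m) = p}
  have hφ : ∀ p ∈ derived A w, Embeds (piece p) (B ∩ cell m (g p)) := by
    intro p hp
    refine embeds_of_derived_subset_singleton w _ p (fun x hx => ?_) _ _ (hg hp) _
    exact (hr' _ x (derived_mono inter_subset_left w hx) rfl).trans (derived_subset hx).2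
  choose! φ hφc hφm hφi using hφ
  have hmem : ∀ x ∈ A, x ∈ piece (r (x.F m)) := fun x hx => ⟨hx, rfl⟩
  refine ⟨fun x => φ (r (x.F m)) x, fun x hx => ?_, fun x hx => ?_, fun x hx y hy hxy => ?_⟩
  · have hU : {y : ASet | r (y.F m) = r (x.F m)} ∈ 𝓝 x :=
      mem_of_superset (cell_mem_nhds m x) fun y hy => congrArg r hy
    have hcont : ContinuousWithinAt (φ (r (x.F m))) A x :=
      (continuousWithinAt_inter hU).1 (hφc _ (hr _) x (hmem x hx))
    refine hcont.congr_of_eventuallyEq ?_ rfl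
    filter_upwards [mem_nhdsWithin_of_mem_nhds hU] with y hy
    rw [show r (y.F m) = r (x.F m) from hy]
  · exact (hφm _ (hr _) (hmem x hx)).1
  · have hx' := (hφm _ (hr _) (hmem x hx)).2
    have hy' := (hφm _ (hr _) (hmem y hy)).2
    have hgr : g (r (x.F m)) = g (r (y.F m)) := by
      refine hm₂ (mem_image_of_mem g (hr _)) (mem_image_of_mem g (hr _)) ?_
      exact hx'.symm.trans ((congrArg (fun z : ASet => z.F m) hxy).trans hy')
    have hrr := hinj (hr _) (hr _) hgr
    simp only [← hrr] at hxy
    exact hφi _ (hr _) (hmem x hx) (hrr ▸ hmem y hy) hxy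

theorem derivedSet_eq_empty_iff {S : Set ASet} (hS : IsClosed S) :
    derivedSet S = ∅ ↔ S.Finite := by
  constructor
  · intro h
    by_contra hinf
    obtain ⟨x, -, hx⟩ := Set.Infinite.exists_accPt_of_subset_isCompact hinf hS.isCompact le_rfl
    exact (h ▸ (hx : x ∈ derivedSet S) : x ∈ (∅ : Set ASet))
  · intro h
    refine eq_empty_of_forall_notMem fun x hx => ?_
    obtain ⟨k, hk⟩ := exists_injOn_F (h.insert x)
    obtain ⟨y, hy, hyx, hyc⟩ := mem_derivedSet_iff_cell.1 hx k
    exact hyx (hk k le_rfl (mem_insert_of_mem _ hy) (mem_insert _ _) hyc)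

/-- A nonempty closed set has points of rank `w` if it has accumulation points of all smaller
ranks. -/
theorem derived_nonempty (hA : IsClosed A) (hne : A.Nonempty)
    (h : ∀ v < w, (derivedSet (derived A v)).Nonempty) : (derived A w).Nonempty := by
  rcases isEmpty_or_nonempty (Iio w) with he | ⟨⟨v₀⟩⟩
  · obtain ⟨x, hx⟩ := hne
    exact ⟨x, mem_derived.2 ⟨hx, fun v hv => he.elim ⟨v, hv⟩⟩⟩
  · have : Nonempty (Iio w) := ⟨v₀⟩
    have hne := IsCompact.nonempty_iInter_of_directed_nonempty_isCompact_isClosed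
      (fun v : Iio w => derivedSet (derived A v.1))
      (Antitone.directed_ge (α := Iio w) fun u v huv =>
        derivedSet_mono _ _ (derived_antitone hA huv))
      (fun v => h v.1 v.2) (fun v => (isClosed_derivedSet _).isCompact)
      (fun v => isClosed_derivedSet _)
    obtain ⟨x, hx⟩ := hne
    rw [mem_iInter] at hx
    refine ⟨x, mem_derived.2 ⟨?_, fun v hv => hx ⟨v, hv⟩⟩⟩
    exact derived_subset (derivedSet_derived_subset hA v₀.1 (hx v₀))

/-- `w` is the Cantor–Bendixson rank of the closed set `A`. -/
def IsRank (A : Set ASet) (w : W) : Prop :=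
  derivedSet (derived A w) = ∅ ∧ ∀ v, derivedSet (derived A v) = ∅ → w ≤ v

theorem IsRank.finite (h : IsRank A w) (hA : IsClosed A) : (derived A w).Finite :=
  (derivedSet_eq_empty_iff (isClosed_derived hA w)).1 h.1

theorem IsRank.eq_empty (h : IsRank A w) (hA : IsClosed A) (he : derived A w = ∅) : A = ∅ := by
  by_contra hne
  refine (derived_nonempty hA (nonempty_iff_ne_empty.2 hne) fun v hv => ?_).ne_empty he
  exact nonempty_iff_ne_empty.2 fun h0 => (h.2 v h0).not_gt hv

/-- Comparison of countable compact sets: embeddability is the lexicographic order of rank and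
degree. -/
theorem embeds_iff (hA : IsClosed A) (hB : IsClosed B) (hv : IsRank A v) (hw : IsRank B w) :
    Embeds A B ↔ v < w ∨ v = w ∧ (derived A v).ncard ≤ (derived B w).ncard := by
  constructor
  · rintro ⟨φ, hc, hm, hinj⟩
    have hmap := mapsTo_derived (W := W) hc hm hinj
    have hle : v ≤ w := hv.2 w <| eq_empty_of_forall_notMem fun x hx => by
      have := mapsTo_derivedSet (derived_subset (derivedSet_derived_subset hA w hx)) hc hinj
        derived_subset (hmap w) hx
      rw [hw.1] at this
      exact this
    refine hle.lt_or_eq.imp_right ?_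
    rintro rfl
    exact ⟨rfl, ncard_le_ncard_of_injOn φ (hmap v) (hinj.mono derived_subset) (hw.finite hB)⟩
  · intro h
    have hfin := hv.finite hA
    suffices h : ∃ g, MapsTo g (derived A v) (derived B v) ∧ InjOn g (derived A v) by
      obtain ⟨g, hg, hinj⟩ := h
      exact embeds_of_injOn_derived v hfin (hv.eq_empty hA) hg hinj
    refine hfin.exists_injOn_of_encard_le ?_
    rcases h with h | ⟨rfl, h⟩
    -- Below the rank of `B` the derived sets are infinite, so any finite number of points fits in.
    · have hinf : (derived B v).Infinite := fun hf =>
        (hw.2 v ((derivedSet_eq_empty_iff (isClosed_derived hB v)).2 hf)).not_gt h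
      rw [hinf.encard_eq]
      exact le_top
    · rw [← hfin.cast_ncard_eq, ← (hw.finite hB).cast_ncard_eq]
      exact_mod_cast h

end Derived
/-- The ordinals that are zero or successors: the possible order types of compact well-orders. -/
abbrev NonlimitOrd : Type 1 := {o : Ordinal.{0} // o = 0 ∨ ∃ p, o = p + 1}

/-! ### Agreement of the two transfinite recursions -/

namespace WOSet

/-- The order type as an element of `NonlimitOrd`. -/
noncomputable def otype (α : WOSet) : NonlimitOrd := ⟨α.type, α.type_eq_zero_or⟩

variable {α β : WOSet}

theorem ordLE_iff_otype : OrdLE α β ↔ α.otype ≤ β.otype := ordLE_iff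

theorem ordLT_iff_otype : OrdLT α β ↔ α.otype < β.otype := ordLT_iff

theorem ordEq_iff_otype : OrdEq α β ↔ α.otype = β.otype := by
  rw [ordEq_iff, Subtype.ext_iff]
  exact Iff.rfl

theorem exists_otype_eq {w : NonlimitOrd} (h : w ≤ α.otype) : ∃ β : WOSet, β.otype = w := by
  obtain ⟨β, hβ⟩ := exists_type_eq w.2 h
  exact ⟨β, Subtype.ext hβ⟩

theorem exists_between_of_isLimit (hα : IsLimit α) {v : NonlimitOrd} (hv : v < α.otype) :
    ∃ u, v < u ∧ u < α.otype := by
  obtain ⟨β, rfl⟩ := exists_otype_eq hv.le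
  have hβ : β.type < α.type := hv
  refine ⟨⟨β.type + 1, .inr ⟨_, rfl⟩⟩, Order.lt_add_one_iff.2 (le_refl β.type), ?_⟩
  exact lt_of_le_of_ne (Order.add_one_le_iff.2 hβ) fun e =>
    hα.2 ⟨β, isSuccessor_iff.2 (congrArg Subtype.val e).symm⟩

theorem derived_otype_of_isEmptySet (h : IsEmptySet α.carrier) (S : Set ASet) :
    derived S α.otype = S := by
  ext x
  rw [mem_derived]
  refine ⟨fun h => h.1, fun hx => ⟨hx, fun v hv => ?_⟩⟩
  have hv' : v.1 < α.type := hv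
  rw [isEmptySet_carrier_iff.1 h] at hv'
  exact (not_lt_zero hv').elim

theorem derived_otype_of_isSuccessor {S : Set ASet} (hS : IsClosed S) (h : IsSuccessor β α) :
    derived S β.otype = derivedSet (derived S α.otype) := by
  rw [isSuccessor_iff] at h
  have hlt : α.otype < β.otype := by
    change α.type < β.type
    rw [h]
    exact Order.lt_add_one_iff.2 le_rfl
  refine Subset.antisymm (derived_subset_derivedSet hlt) fun x hx => ?_
  refine mem_derived.2 ⟨derived_subset (derivedSet_derived_subset hS _ hx), fun v hv => ?_⟩
  have hv' : v.1 < β.type := hv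
  rw [h, Order.lt_add_one_iff] at hv'
  exact derivedSet_mono _ _ (derived_antitone hS (show v ≤ α.otype from hv')) hx

/-- Below a limit every index `v` has a larger `u`, and stage `u` already lies in the derived set of
stage `v`; deriving once more before intersecting changes nothing. -/
theorem mem_derived_otype_of_isLimit {S : Set ASet} (hS : IsClosed S) (h : IsLimit α) {x : ASet} :
    x ∈ derived S α.otype ↔ ∀ β, OrdLT β α → x ∈ derived S β.otype := by
  constructor
  · exact fun hx β hβ => derived_antitone hS (ordLT_iff_otype.1 hβ).le hx
  · intro hx
    obtain ⟨γ, hγ⟩ := exists_type_eq_zero α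
    have hγα : OrdLT γ α := by
      rw [ordLT_iff, hγ, pos_iff_ne_zero]
      exact fun e => h.1 (isEmptySet_carrier_iff.2 e)
    refine mem_derived.2 ⟨derived_subset (hx γ hγα), fun v hv => ?_⟩
    obtain ⟨u, hvu, hu⟩ := exists_between_of_isLimit h hv
    obtain ⟨β, rfl⟩ := exists_otype_eq hu.le
    exact derived_subset_derivedSet hvu (hx β (ordLT_iff_otype.2 hu))

end WOSet

/-! ### Existence of rank and degree for well-orderable sets -/

open WOSet

variable {A B : ASet}

theorem IsIterDerived.points_eq {α : WOSet} {X : ASet} (h : IsIterDerived A α X) :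
    points X = derived (points A) α.otype := by
  induction h with
  | zero α hα => exact (derived_otype_of_isEmptySet hα _).symm
  | succ α π hα X Y _ hY ih =>
    rw [derived_otype_of_isSuccessor (isClosed_points A) hα, ← ih, isDerivedSet_iff.1 hY]
  | limit α hα X _ Y hY ih =>
    ext x
    rw [mem_points, hY, mem_derived_otype_of_isLimit (isClosed_points A) hα]
    exact forall₂_congr fun β hβ => by rw [← ih β hβ, mem_points]

theorem points_ofSet_derived (w : NonlimitOrd) :
    points (ofSet (derived (points A) w)) = derived (points A) w :=
  points_ofSet (isClosed_derived (isClosed_points A) w)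

theorem isIterDerived_ofSet (A : ASet) (α : WOSet) :
    IsIterDerived A α (ofSet (derived (points A) α.otype)) := by
  induction h : α.otype using WellFoundedLT.induction generalizing α with
  | ind w ih =>
    subst h
    by_cases h0 : IsEmptySet α.carrier
    · have : ofSet (derived (points A) α.otype) = A :=
        points_injective (by rw [points_ofSet_derived, derived_otype_of_isEmptySet h0])
      rw [this]
      exact .zero α h0
    by_cases hs : ∃ π, IsSuccessor α π
    · obtain ⟨π, hπ⟩ := hs
      have hlt : π.otype < α.otype := by
        change π.type < α.type
        rw [isSuccessor_iff.1 hπ]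
        exact Order.lt_add_one_iff.2 le_rfl
      refine .succ α π hπ _ _ (ih _ hlt π rfl) (isDerivedSet_iff.2 ?_)
      rw [points_ofSet_derived, points_ofSet_derived,
        derived_otype_of_isSuccessor (isClosed_points A) hπ]
    · refine .limit α ⟨h0, hs⟩ (fun β => ofSet (derived (points A) β.otype))
        (fun β hβ => ih _ (ordLT_iff_otype.1 hβ) β rfl) _ fun x => ?_
      simp only [← mem_points, points_ofSet_derived]
      exact mem_derived_otype_of_isLimit (isClosed_points A) ⟨h0, hs⟩

theorem derivesToDiscrete_iff {α : WOSet} :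
    DerivesToDiscrete A α ↔ derivedSet (derived (points A) α.otype) = ∅ := by
  constructor
  · rintro ⟨X, hX, Z, hZ, hZe⟩
    rw [← hX.points_eq, ← isDerivedSet_iff.1 hZ, isEmptySet_iff.1 hZe]
  · intro h
    refine ⟨_, isIterDerived_ofSet A α, ofSet ∅, isDerivedSet_iff.2 ?_, isEmptySet_iff.2 ?_⟩
    · rw [points_ofSet_derived, h, points_ofSet isClosed_empty]
    · exact points_ofSet isClosed_empty

/-- `IsRank` minimizes over all nonlimit order types, `IsCBRank` only over realized ones. A smaller
competitor would lie below `ρ.otype` and hence be realized. -/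
theorem isCBRank_iff {ρ : WOSet} : IsCBRank A ρ ↔ IsRank (points A) ρ.otype := by
  simp only [IsCBRank, IsRank, derivesToDiscrete_iff, ordLE_iff_otype]
  refine and_congr_right fun _ => ⟨fun h v hv => ?_, fun h β => h _⟩
  by_contra! hlt
  obtain ⟨β, rfl⟩ := exists_otype_eq hlt.le
  exact (h β hv).not_gt hlt

/-- The points of the iterated derived set of index `w` have position at least `w - 1`. -/
theorem WOSet.otype_le_of_mem_derived (α : WOSet) (w : NonlimitOrd) (x : α.El)
    (h : x.1 ∈ derived (points α.carrier) w) : w.1 ≤ idx x + 1 := by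
  induction x using WellFoundedLT.induction generalizing w with
  | ind x ih =>
    by_contra! hlt
    -- As `u < w`, points of stage `u` accumulate at `x`. By upward isolation one of them precedes
    -- `x`, but induction gives it at least the position of `x`.
    let u : NonlimitOrd := ⟨idx x + 1, .inr ⟨_, rfl⟩⟩
    obtain ⟨n, hn⟩ := exists_cell_forall_le x
    have hx := derived_subset_derivedSet (show u < w from hlt) h
    obtain ⟨y, hy, hyx, hyn⟩ := mem_derivedSet_iff_cell.1 hx n
    let y' : α.El := ⟨y, derived_subset hy⟩
    have hlt' : y' < x := lt_of_le_of_ne (hn y' hyn) fun e => hyx (congrArg El.val e)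
    have hle : idx x + 1 ≤ idx y' + 1 := ih y' hlt' u hy
    exact (Order.add_one_le_iff.1 hle |> Order.lt_add_one_iff.1).not_gt (idx_lt_idx.2 hlt')

/-- An accumulation point would exceed some element of that last stage, whose position plus one is
already at least `α.type`. This bounds the rank by a realized order type, so the rank is itself an
ordinal of the theory. -/
theorem WOSet.derivedSet_derived_otype (α : WOSet) :
    derivedSet (derived (points α.carrier) α.otype) = ∅ := by
  refine eq_empty_of_forall_notMem fun x hx => ?_
  have hxα := derived_subset (derivedSet_derived_subset (isClosed_points _) _ hx)
  let x' : α.El := ⟨x, hxα⟩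
  obtain ⟨n, hn⟩ := exists_cell_forall_le x'
  obtain ⟨y, hy, hyx, hyn⟩ := mem_derivedSet_iff_cell.1 hx n
  let y' : α.El := ⟨y, derived_subset hy⟩
  have hlt : y' < x' := lt_of_le_of_ne (hn y' hyn) fun e => hyx (congrArg El.val e)
  have h1 : α.type ≤ idx y' + 1 := α.otype_le_of_mem_derived α.otype y' hy
  exact (h1.trans (Order.add_one_le_iff.2 (idx_lt_idx.2 hlt))).not_gt (idx_lt_type x')

theorem exists_isCBRank (hA : WellOrderable A) : ∃ ρ, IsCBRank A ρ := by
  obtain ⟨R, hR⟩ := hA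
  let α : WOSet := ⟨A, R, hR⟩
  let s : Set NonlimitOrd := {w | derivedSet (derived (points A) w) = ∅}
  have hs : α.otype ∈ s := α.derivedSet_derived_otype
  obtain ⟨w, hw, hmin⟩ := WellFounded.has_min (wellFounded_lt (α := NonlimitOrd)) s ⟨_, hs⟩
  obtain ⟨ρ, rfl⟩ := exists_otype_eq (not_lt.1 (hmin _ hs))
  exact ⟨ρ, isCBRank_iff.2 ⟨hw, fun v hv => not_lt.1 (hmin v hv)⟩⟩

theorem IsCBRank.points_eq {ρ : WOSet} {D : ASet} (hρ : IsCBRank A ρ) (hD : IsCBDegree A D) :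
    points D = derived (points A) ρ.otype := by
  obtain ⟨σ, hσ, hD⟩ := hD
  rw [isCBRank_iff] at hρ hσ
  rw [hD.points_eq, le_antisymm (hρ.2 _ hσ.1) (hσ.2 _ hρ.1)]

theorem existsUnique_isCBDegree (hA : WellOrderable A) : ∃! D, IsCBDegree A D := by
  obtain ⟨ρ, hρ⟩ := exists_isCBRank hA
  refine ⟨_, ⟨ρ, hρ, isIterDerived_ofSet A ρ⟩, fun D hD => points_injective ?_⟩
  rw [hρ.points_eq hD, points_ofSet_derived]

theorem IsCBDegree.wellOrderable (hA : WellOrderable A) {D : ASet} (hD : IsCBDegree A D) :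
    WellOrderable D := by
  obtain ⟨R, hR⟩ := hA
  obtain ⟨ρ, -, hD⟩ := hD
  obtain ⟨R', hR', -⟩ := hR.restrict (S := D) fun x hx => by
    rw [← mem_points, hD.points_eq] at hx
    exact derived_subset hx
  exact ⟨R', hR'⟩

/-- Degrees are finite, so the chosen well-orderings do not affect their order types. -/
theorem WOSet.type_eq_ncard {α : WOSet} (h : (points α.carrier).Finite) :
    α.type = (points α.carrier).ncard := by
  have hr : range (El.val : α.El → ASet) = points α.carrier :=
    Set.ext fun x => ⟨by rintro ⟨y, rfl⟩; exact y.2, fun h => ⟨⟨x, h⟩, rfl⟩⟩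
  have : Finite α.El := Finite.of_finite_image (f := El.val) (s := univ)
    (by rwa [image_univ, hr]) isClosedEmbedding_val.injective.injOn |> finite_univ_iff.1
  have := Fintype.ofFinite α.El
  rw [WOSet.type, Ordinal.type_fintype, ← Nat.card_eq_fintype_card, ← hr,
    ← Nat.card_range_of_injective isClosedEmbedding_val.injective]
  rfl

theorem cardLE_iff_rank {ρA ρB δA δB : WOSet} (hρA : IsCBRank A ρA) (hρB : IsCBRank B ρB)
    (hδA : IsCBDegree A δA.carrier) (hδB : IsCBDegree B δB.carrier) :
    CardLE A B ↔ ρA.otype < ρB.otype ∨ ρA.otype = ρB.otype ∧ δA.type ≤ δB.type := by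
  have hA := hρA.points_eq hδA
  have hB := hρB.points_eq hδB
  rw [isCBRank_iff] at hρA hρB
  have fA := hρA.finite (isClosed_points A)
  have fB := hρB.finite (isClosed_points B)
  rw [cardLE_iff, embeds_iff (isClosed_points A) (isClosed_points B) hρA hρB,
    type_eq_ncard (hA ▸ fA), type_eq_ncard (hB ▸ fB), hA, hB, Nat.cast_le]

end AS

theorem theorem8p20 (A B : AS.ASet) (hA : AS.WellOrderable A) (hB : AS.WellOrderable B) :
    -- Cantor–Bendixson ranks exist, and the degrees are sets that can be well-ordered
    ((∃ ρ, AS.IsCBRank A ρ) ∧ (∃! D, AS.IsCBDegree A D) ∧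
      ∀ D, AS.IsCBDegree A D → AS.WellOrderable D) ∧
    ((∃ ρ, AS.IsCBRank B ρ) ∧ (∃! D, AS.IsCBDegree B D) ∧
      ∀ D, AS.IsCBDegree B D → AS.WellOrderable D) ∧
    -- the comparison holds for all choices of the ranks and of orderings of the degrees
    ∀ ρA ρB δA δB : AS.WOSet,
      AS.IsCBRank A ρA → AS.IsCBRank B ρB →
      AS.IsCBDegree A δA.carrier → AS.IsCBDegree B δB.carrier →
      (AS.CardEq A B ↔ AS.OrdEq ρA ρB ∧ AS.OrdEq δA δB) ∧
      (AS.CardLT A B ↔ AS.OrdLT ρA ρB ∨ (AS.OrdEq ρA ρB ∧ AS.OrdLT δA δB)) := by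
  refine ⟨⟨AS.exists_isCBRank hA, AS.existsUnique_isCBDegree hA, fun _ h => h.wellOrderable hA⟩,
    ⟨AS.exists_isCBRank hB, AS.existsUnique_isCBDegree hB, fun _ h => h.wellOrderable hB⟩, ?_⟩
  intro ρA ρB δA δB hρA hρB hδA hδB
  have hAB := AS.cardLE_iff_rank hρA hρB hδA hδB
  have hBA := AS.cardLE_iff_rank hρB hρA hδB hδA
  simp only [AS.CardLT, AS.CardEq, hAB, hBA, AS.WOSet.ordEq_iff_otype (α := ρA),
    AS.WOSet.ordEq_iff (α := δA), AS.WOSet.ordLT_iff_otype (α := ρA),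
    AS.WOSet.ordLT_iff (α := δA)]
  -- Both equivalences are now statements about the lexicographic order of rank and degree.
  rcases lt_trichotomy ρA.otype ρB.otype with h | h | h
  · simp [h, h.ne, h.ne', h.not_gt]
  · simp only [h, lt_irrefl, false_or, true_and, le_antisymm_iff, lt_iff_le_not_ge]
    tauto
  · simp [h, h.ne, h.ne', h.not_gt]
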